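/- Let $H$ and $U$ be complex Hilbert spaces, let $A:\mathcal D(A)\subset H\to H$ be a self-adjoint, positive and invertible (bijective from $\mathcal D(A)$ onto $H$) operator, let $B\in\mathcal L(U,H)$, and let $\mu\in\mathbb R$, $T_0>0$, $\xi>0$ with $\xi\ge|\mu|T_0$. Put $H_1=\mathcal D(A)$ and $H_{1/2}=\mathcal D(A^{1/2})$ with norm $\|A^{1/2}\cdot\|_H$, and let $\mathcal H_g=H_{1/2}\times H\times L^2(0,1;U)$ with the inner product $$((u,v,z),(u_1,v_1,z_1))_{\mathcal H_g}=(A^{1/2}u,A^{1/2}u_1)_H+(v,v_1)_H+\xi\int_0^1(z,z_1)_U\,d\rho .$$ Let $\mathcal A_g$ be the operator $$\mathcal A_g(u,v,z)=\bigl(v,\,-Au-\mu Bz(1),\,-T_0^{-1}z_\rho\bigr),\qquad \mathcal D(\mathcal A_g)=\{(u,v,z)\in H_1\times H_{1/2}\times H^1(0,1;U): z(0)=B^*v\}.$$ Consider the delay system $$\ddot u(t)+Au(t)=0\ (0\le t\le T_0),\qquad \ddot u(t)+Au(t)+\mu BB^*\dot u(t-T_0)=0\ (t\ge T_0),\qquad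 u(0)=u_0,\ \dot u(0)=u_1 \tag{D}$$ and the Cauchy problem $$\dot X=\mathcal A_gX,\qquad X(0)=(u_0,u_1,0). \tag{C}$$ Then: 1. With $c=\left(\frac{|\mu|}{2}+\frac{\xi}{2T_0}\right)\|B^*\|^2_{\mathcal L(H,U)}$, the operator $\mathcal A_g-c\,\mathrm{Id}$ is maximal dissipative in $\mathcal H_g$, i.e. $\mathrm{Re}\,((\mathcal A_g-c)x,x)_{\mathcal H_g}\le 0$ for all $x\in\mathcal D(\mathcal A_g)$, and $\lambda\,\mathrm{Id}-(\mathcal A_g-c\,\mathrm{Id})$ maps $\mathcal D(\mathcal A_g)$ onto $\mathcal H_g$ for every $\lambda>0$. 2. For every $(u_0,u_1)\in H_{1/2}\times H$, problem (C) has a unique mild solution $X=(u,v,z)\in C([0,\infty),\mathcal H_g)$, that is, a unique continuous $X$ such that $\int_0^tX(s)\,ds\in\mathcal D(\mathcal A_g)$ and $X(t)=(u_0,u_1,0)+\mathcal A_g\int_0^tX(s)\,ds$ for all $t\ge0$. 3. If $(u_0,u_1,0)\in\mathcal D(\mathcal A_g)$, then this solution is classical: $X\in C([0,\infty),\mathcal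 D(\mathcal A_g))\cap C^1([0,\infty),\mathcal H_g)$ (with the graph norm on $\mathcal D(\mathcal A_g)$) and (C) holds for all $t\ge0$. Moreover $v=\dot u$; the function $u$ solves (D), and it is the only function in $C^2([0,\infty),H)$ with values in $\mathcal D(A)$ that solves (D); and for every $t\ge0$ and almost every $\rho\in(0,1)$, $z(\rho,t)=B^*\dot u(t-T_0\rho)$ if $T_0\rho\le t$ and $z(\rho,t)=0$ if $T_0\rho>t$. -/

import Mathlib

noncomputable section

open Set MeasureTheory
open scoped InnerProductSpace ContDiff
set_option linter.unusedSectionVars false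

namespace DelayWave

/-- A (possibly unbounded) self-adjoint, positive and invertible operator on a complex Hilbert
space `H`. Invertible means that it is a bijection from its domain onto `H`. Self-adjointness of a
`LinearPMap` includes the density of the domain. -/
structure PosInvOp (H : Type*) [NormedAddCommGroup H] [InnerProductSpace ℂ H]
    [CompleteSpace H] where
  /-- the operator, as a linear map on its domain -/
  op : H →ₗ.[ℂ] H
  isSelfAdjoint : IsSelfAdjoint op
  nonneg : ∀ x : op.domain, 0 ≤ (⟪(x : H), op x⟫_ℂ).re
  bijective : Function.Bijective op

section Sqrt

variable {H : Type*} [NormedAddCommGroup H] [InnerProductSpace ℂ H] [CompleteSpace H]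

namespace PosInvOp

variable (A : PosInvOp H)

/-- The linear bijection `A : D(A) → H`. -/
def equiv : A.op.domain ≃ₗ[ℂ] H := LinearEquiv.ofBijective A.op.toFun A.bijective

lemma op_symm (x y : A.op.domain) : ⟪A.op x, (y : H)⟫_ℂ = ⟪(x : H), A.op y⟫_ℂ := by
  have h := LinearPMap.adjoint_isFormalAdjoint A.isSelfAdjoint.dense_domain
  rw [LinearPMap.isSelfAdjoint_def.mp A.isSelfAdjoint] at h
  exact h x y

/-- `A⁻¹` as a linear map of `H`. -/
def invₗ : H →ₗ[ℂ] H := A.op.domain.subtype ∘ₗ A.equiv.symm.toLinearMap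

lemma op_equiv_symm (x : H) : A.op (A.equiv.symm x) = x := A.equiv.apply_symm_apply x

lemma invₗ_symm : A.invₗ.IsSymmetric := fun x y => by
  have h := A.op_symm (A.equiv.symm x) (A.equiv.symm y)
  rw [op_equiv_symm, op_equiv_symm] at h
  exact h.symm

/-- The bounded operator `A⁻¹` (everywhere defined and symmetric, hence continuous). -/
def inv : H →L[ℂ] H := ⟨A.invₗ, A.invₗ_symm.continuous⟩

lemma inv_apply (x : H) : A.inv x = (A.equiv.symm x : H) := rfl

lemma inv_nonneg : 0 ≤ A.inv := by
  rw [ContinuousLinearMap.nonneg_iff_isPositive]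
  refine ⟨A.invₗ_symm, fun x => ?_⟩
  have h := A.nonneg (A.equiv.symm x)
  rw [op_equiv_symm] at h
  exact h

/-- The bounded operator `A^{-1/2}`, the positive square root of `A⁻¹`. -/
def invSqrt : H →L[ℂ] H := CFC.sqrt A.inv

lemma invSqrt_invSqrt (x : H) : A.invSqrt (A.invSqrt x) = A.inv x := by
  have h := CFC.sqrt_mul_sqrt_self A.inv A.inv_nonneg
  exact congrArg (fun T : H →L[ℂ] H => T x) h

lemma invSqrt_injective : Function.Injective A.invSqrt := by
  rw [injective_iff_map_eq_zero]
  intro x hx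
  have h : A.inv x = 0 := by rw [← invSqrt_invSqrt, hx, map_zero]
  have h2 : A.equiv.symm x = 0 := Subtype.ext h
  simpa using h2

/-- The square root `A^{1/2}`, the inverse of `A^{-1/2}`; its domain is the range of
`A^{-1/2}`. -/
def sqrt : H →ₗ.[ℂ] H := (A.invSqrt.toLinearMap.toPMap ⊤).inverse

lemma sqrt_ker : LinearMap.ker (A.invSqrt.toLinearMap.toPMap ⊤).toFun = ⊥ := by
  rw [LinearMap.ker_eq_bot']
  intro x hx
  exact Subtype.ext ((injective_iff_map_eq_zero A.invSqrt).mp A.invSqrt_injective x hx)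

lemma mem_sqrt_domain {x : H} : x ∈ A.sqrt.domain ↔ ∃ y, A.invSqrt y = x := by
  rw [sqrt, LinearPMap.inverse_domain, LinearMap.mem_range]
  exact ⟨fun ⟨y, hy⟩ => ⟨y, hy⟩, fun ⟨y, hy⟩ => ⟨⟨y, trivial⟩, hy⟩⟩

lemma sqrt_invSqrt (y : H) : A.sqrt ⟨A.invSqrt y, A.mem_sqrt_domain.mpr ⟨y, rfl⟩⟩ = y :=
  LinearPMap.inverse_apply_eq A.sqrt_ker (x := ⟨y, trivial⟩) rfl

lemma invSqrt_sqrt (x : A.sqrt.domain) : A.invSqrt (A.sqrt x) = x := by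
  obtain ⟨x, hx⟩ := x
  obtain ⟨y, rfl⟩ := A.mem_sqrt_domain.mp hx
  rw [sqrt_invSqrt]

lemma sqrt_bijective : Function.Bijective A.sqrt.toFun :=
  ⟨fun x y h => Subtype.ext (by
      rw [← A.invSqrt_sqrt x, ← A.invSqrt_sqrt y]; exact congrArg A.invSqrt h),
    fun y => ⟨_, A.sqrt_invSqrt y⟩⟩

/-- The space `H_{1/2} = D(A^{1/2})`, with inner product `⟪A^{1/2} x, A^{1/2} y⟫`. -/
def Half : Type _ := A.sqrt.domain

instance : AddCommGroup A.Half := inferInstanceAs (AddCommGroup A.sqrt.domain)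

instance : Module ℂ A.Half := inferInstanceAs (Module ℂ A.sqrt.domain)

/-- The inclusion `H_{1/2} ⊆ H`. -/
def incl : A.Half →ₗ[ℂ] H := A.sqrt.domain.subtype

/-- `A^{1/2} : H_{1/2} → H`. -/
def sqrtHalf : A.Half →ₗ[ℂ] H := A.sqrt.toFun

instance : NormedAddCommGroup A.Half :=
  NormedAddCommGroup.induced A.Half H A.sqrtHalf A.sqrt_bijective.1

instance : InnerProductSpace ℂ A.Half where
  inner x y := ⟪A.sqrtHalf x, A.sqrtHalf y⟫_ℂ
  norm_smul_le c x := by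
    change ‖A.sqrtHalf (c • x)‖ ≤ ‖c‖ * ‖A.sqrtHalf x‖
    rw [map_smul, norm_smul]
  norm_sq_eq_re_inner x := norm_sq_eq_re_inner (𝕜 := ℂ) (A.sqrtHalf x)
  conj_inner_symm x y := inner_conj_symm (𝕜 := ℂ) (A.sqrtHalf x) (A.sqrtHalf y)
  add_left x y z := by
    change ⟪A.sqrtHalf (x + y), A.sqrtHalf z⟫_ℂ = _
    rw [map_add, inner_add_left]
  smul_left x y r := by
    change ⟪A.sqrtHalf (r • x), A.sqrtHalf y⟫_ℂ = _
    rw [map_smul, inner_smul_left]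

/-- `A^{1/2}` as an isometric isomorphism of `H_{1/2}` onto `H`. -/
def sqrtIso : A.Half ≃ₗᵢ[ℂ] H :=
  { LinearEquiv.ofBijective A.sqrtHalf A.sqrt_bijective with
    norm_map' := fun _ => rfl }

instance : CompleteSpace A.Half :=
  (completeSpace_congr (e := A.sqrtIso.toEquiv)
    A.sqrtIso.isometry.isUniformInducing.isUniformEmbedding).mpr inferInstance

end PosInvOp

end Sqrt

section Evolution

variable {E : Type*} [NormedAddCommGroup E] [InnerProductSpace ℂ E]

/-- `X ∈ C([0,∞), E)` is a mild solution of `X' = G X`, `X(0) = x₀`: for every `t ≥ 0`, the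
integral `∫₀ᵗ X` lies in `D(G)` and `X(t) = x₀ + G ∫₀ᵗ X`. Only the values of `X` on `[0,∞)`
matter. -/
def IsMildSolution (G : E →ₗ.[ℂ] E) (x₀ : E) (X : ℝ → E) : Prop :=
  ContinuousOn X (Ici 0) ∧
    ∀ t, 0 ≤ t → ∃ h : (∫ s in (0 : ℝ)..t, X s) ∈ G.domain,
      X t = x₀ + G ⟨∫ s in (0 : ℝ)..t, X s, h⟩

/-- `X ∈ C([0,∞), D(G)) ∩ C¹([0,∞), E)` (with the graph norm on `D(G)`; the derivative at `0` is
one-sided), `X' = G X` on `[0,∞)` and `X(0) = x₀`. Here `Y = G X = X'`. -/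
def IsClassicalSolution (G : E →ₗ.[ℂ] E) (x₀ : E) (X : ℝ → E) : Prop :=
  X 0 = x₀ ∧ ContinuousOn X (Ici 0) ∧
    ∃ Y : ℝ → E, ContinuousOn Y (Ici 0) ∧
      ∀ t, 0 ≤ t → (∃ h : X t ∈ G.domain, G ⟨X t, h⟩ = Y t) ∧
        HasDerivWithinAt X (Y t) (Ici 0) t

/-- `G - c Id` is maximal dissipative: `Re ⟪(G - c) x, x⟫ ≤ 0` on `D(G)`, and
`l Id - (G - c Id)` maps `D(G)` onto `E` for every `l > 0`. -/
def IsMaximalDissipativeShift (G : E →ₗ.[ℂ] E) (c : ℝ) : Prop :=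
  (∀ x : G.domain, (⟪(x : E), G x - c • (x : E)⟫_ℂ).re ≤ 0) ∧
    ∀ l : ℝ, 0 < l → ∀ y : E, ∃ x : G.domain, l • (x : E) - (G x - c • (x : E)) = y

end Evolution

section Generator

variable {H : Type*} [NormedAddCommGroup H] [InnerProductSpace ℂ H] [CompleteSpace H]
variable {U : Type*} [NormedAddCommGroup U] [InnerProductSpace ℂ U] [CompleteSpace U]

/-- `L²(0,1;U)` with the inner product `ξ ∫₀¹ ⟪z, z₁⟫ dρ`, obtained by weighting Lebesgue measure
on `(0,1)` by the constant `ξ`. -/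
abbrev L2 (U : Type*) [NormedAddCommGroup U] (ξ : ℝ) : Type _ :=
  Lp U 2 (ENNReal.ofReal ξ • (volume : Measure ℝ).restrict (Ioo 0 1))

/-- The space `H_{1/2} × H × L²(0,1;U)` with inner product
`⟪A^{1/2}u, A^{1/2}u₁⟫ + ⟪v, v₁⟫ + ξ ∫₀¹ ⟪z, z₁⟫ dρ`. -/
abbrev Hg (A : PosInvOp H) (U : Type*) [NormedAddCommGroup U] [InnerProductSpace ℂ U]
    (ξ : ℝ) : Type _ :=
  WithLp 2 (A.Half × WithLp 2 (H × L2 U ξ))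

namespace Hg

variable {A : PosInvOp H} {ξ : ℝ}

/-- The element `(u, v, z)`. -/
def mk (u : A.Half) (v : H) (z : L2 U ξ) : Hg A U ξ := WithLp.toLp 2 (u, WithLp.toLp 2 (v, z))

/-- First component. -/
def u (X : Hg A U ξ) : A.Half := X.fst

/-- Second component. -/
def v (X : Hg A U ξ) : H := X.snd.fst

/-- Third component. -/
def z (X : Hg A U ξ) : L2 U ξ := X.snd.snd

end Hg

/-- `w` is the weak derivative of `z` on `(0,1)`. -/
def IsWeakDeriv (z w : ℝ → U) : Prop :=
  ∀ φ : ℝ → ℝ, ContDiff ℝ ∞ φ → HasCompactSupport φ → tsupport φ ⊆ Ioo 0 1 →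
    ∫ ρ in Ioo (0 : ℝ) 1, deriv φ ρ • z ρ = - ∫ ρ in Ioo (0 : ℝ) 1, φ ρ • w ρ

/-- `zc` is the representative of `z` that is continuous on `[0,1]`; the traces of
`z ∈ H¹(0,1;U)` at `0` and `1` are `zc 0` and `zc 1`. -/
def IsContRepr (z zc : ℝ → U) : Prop :=
  ContinuousOn zc (Icc 0 1) ∧ z =ᵐ[volume.restrict (Ioo 0 1)] zc

/-- `x = (u, v, z) ∈ H_1 × H_{1/2} × H¹(0,1;U)`, `z(0) = B^* v`, and
`y = (v, -A u - μ B z(1), -T₀⁻¹ z_ρ)`. -/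
def GenRel (A : PosInvOp H) (B : U →L[ℂ] H) (μ T₀ ξ : ℝ) (x y : Hg A U ξ) : Prop :=
  ∃ (hu : A.incl x.u ∈ A.op.domain) (w : L2 U ξ) (zc : ℝ → U),
    IsWeakDeriv x.z w ∧ IsContRepr x.z zc ∧
    zc 0 = B.adjoint x.v ∧
    A.incl y.u = x.v ∧
    y.v = - A.op ⟨A.incl x.u, hu⟩ - μ • B (zc 1) ∧
    y.z = - (T₀⁻¹ • w)

section Facts

variable {A : PosInvOp H} {B : U →L[ℂ] H} {μ T₀ ξ : ℝ}

lemma absCont (hξ : 0 < ξ) : (volume : Measure ℝ).restrict (Ioo 0 1) ≪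
    ENNReal.ofReal ξ • (volume : Measure ℝ).restrict (Ioo 0 1) :=
  Measure.absolutelyContinuous_smul (by simpa using hξ)

lemma L2.integrableOn (hξ : 0 < ξ) (z : L2 U ξ) : IntegrableOn z (Ioo 0 1) := by
  have h1 : MemLp z 2 (volume.restrict (Ioo (0 : ℝ) 1)) := by
    have h := (Lp.memLp z).smul_measure (c := (ENNReal.ofReal ξ)⁻¹) (by simpa using hξ)
    rwa [smul_smul, ENNReal.inv_mul_cancel (by simpa using hξ) ENNReal.ofReal_ne_top,
      one_smul] at h
  exact h1.integrable (by norm_num)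

lemma integrable_test {φ : ℝ → ℝ} (h1 : Continuous φ) (h2 : HasCompactSupport φ) {z : ℝ → U}
    (hz : IntegrableOn z (Ioo 0 1)) : Integrable (fun ρ => φ ρ • z ρ)
      (volume.restrict (Ioo 0 1)) := by
  obtain ⟨C, hC⟩ := h2.exists_bound_of_continuous h1
  refine Integrable.mono' (hz.norm.const_mul C)
    (h1.aestronglyMeasurable.smul hz.aestronglyMeasurable)
    (Filter.Eventually.of_forall fun ρ => ?_)
  rw [norm_smul]
  exact mul_le_mul_of_nonneg_right (hC ρ) (norm_nonneg _)

lemma IsWeakDeriv.lin {z₁ w₁ z₂ w₂ z w : ℝ → U} (a b : ℂ)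
    (hz₁ : IntegrableOn z₁ (Ioo 0 1)) (hz₂ : IntegrableOn z₂ (Ioo 0 1))
    (hw₁ : IntegrableOn w₁ (Ioo 0 1)) (hw₂ : IntegrableOn w₂ (Ioo 0 1))
    (h₁ : IsWeakDeriv z₁ w₁) (h₂ : IsWeakDeriv z₂ w₂)
    (hz : z =ᵐ[volume.restrict (Ioo 0 1)] fun ρ => a • z₁ ρ + b • z₂ ρ)
    (hw : w =ᵐ[volume.restrict (Ioo 0 1)] fun ρ => a • w₁ ρ + b • w₂ ρ) :
    IsWeakDeriv z w := by
  intro φ h1 h2 h3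
  have key : ∀ (ψ : ℝ → ℝ) (f f₁ f₂ : ℝ → U), Continuous ψ → HasCompactSupport ψ →
      IntegrableOn f₁ (Ioo 0 1) → IntegrableOn f₂ (Ioo 0 1) →
      f =ᵐ[volume.restrict (Ioo 0 1)] (fun ρ => a • f₁ ρ + b • f₂ ρ) →
      ∫ ρ in Ioo (0 : ℝ) 1, ψ ρ • f ρ =
        a • (∫ ρ in Ioo (0 : ℝ) 1, ψ ρ • f₁ ρ) + b • ∫ ρ in Ioo (0 : ℝ) 1, ψ ρ • f₂ ρ := by
    intro ψ f f₁ f₂ hc hs hf₁ hf₂ hf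
    have i₁ : Integrable (fun ρ => a • (ψ ρ • f₁ ρ)) (volume.restrict (Ioo 0 1)) :=
      (integrable_test hc hs hf₁).smul a
    have i₂ : Integrable (fun ρ => b • (ψ ρ • f₂ ρ)) (volume.restrict (Ioo 0 1)) :=
      (integrable_test hc hs hf₂).smul b
    rw [← integral_smul, ← integral_smul, ← integral_add i₁ i₂]
    refine integral_congr_ae (hf.mono fun ρ hρ => ?_)
    simp only [hρ, smul_add, smul_comm (ψ ρ)]
  rw [key _ _ _ _ (h1.continuous_deriv (by simp)) h2.deriv hz₁ hz₂ hz,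
    key _ _ _ _ h1.continuous h2 hw₁ hw₂ hw, h₁ φ h1 h2 h3, h₂ φ h1 h2 h3]
  simp only [smul_neg, neg_add]

lemma IsContRepr.lin {z₁ c₁ z₂ c₂ z : ℝ → U} (a b : ℂ)
    (h₁ : IsContRepr z₁ c₁) (h₂ : IsContRepr z₂ c₂)
    (hz : z =ᵐ[volume.restrict (Ioo 0 1)] fun ρ => a • z₁ ρ + b • z₂ ρ) :
    IsContRepr z (fun ρ => a • c₁ ρ + b • c₂ ρ) := by
  refine ⟨(h₁.1.const_smul a).add (h₂.1.const_smul b), ?_⟩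
  filter_upwards [hz, h₁.2, h₂.2] with ρ h h1 h2
  rw [h, h1, h2]

lemma L2.coe_lin (hξ : 0 < ξ) (a b : ℂ) (z₁ z₂ : L2 U ξ) :
    (a • z₁ + b • z₂ : L2 U ξ) =ᵐ[volume.restrict (Ioo 0 1)]
      fun ρ => a • z₁ ρ + b • z₂ ρ := by
  have h : (a • z₁ + b • z₂ : L2 U ξ) =ᵐ[ENNReal.ofReal ξ • volume.restrict (Ioo 0 1)]
      fun ρ => a • z₁ ρ + b • z₂ ρ := by
    filter_upwards [Lp.coeFn_add (a • z₁) (b • z₂), Lp.coeFn_smul a z₁, Lp.coeFn_smul b z₂]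
      with ρ h1 h2 h3
    rw [h1, Pi.add_apply, h2, h3, Pi.smul_apply, Pi.smul_apply]
  exact (absCont hξ).ae_le h

lemma GenRel.lin (hξ : 0 < ξ) (a b : ℂ) {x₁ y₁ x₂ y₂ : Hg A U ξ}
    (h₁ : GenRel A B μ T₀ ξ x₁ y₁) (h₂ : GenRel A B μ T₀ ξ x₂ y₂) :
    GenRel A B μ T₀ ξ (a • x₁ + b • x₂) (a • y₁ + b • y₂) := by
  obtain ⟨hu₁, w₁, c₁, hw₁, hc₁, hb₁, e₁, f₁, g₁⟩ := h₁
  obtain ⟨hu₂, w₂, c₂, hw₂, hc₂, hb₂, e₂, f₂, g₂⟩ := h₂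
  have hu : A.incl (a • x₁ + b • x₂).u = a • A.incl x₁.u + b • A.incl x₂.u := by
    rw [← map_smul, ← map_smul, ← map_add]; rfl
  have hmem : A.incl (a • x₁ + b • x₂).u ∈ A.op.domain := by
    rw [hu]
    exact A.op.domain.add_mem (A.op.domain.smul_mem a hu₁) (A.op.domain.smul_mem b hu₂)
  have hop : A.op ⟨A.incl (a • x₁ + b • x₂).u, hmem⟩ =
      a • A.op ⟨A.incl x₁.u, hu₁⟩ + b • A.op ⟨A.incl x₂.u, hu₂⟩ := by
    rw [← LinearPMap.map_smul, ← LinearPMap.map_smul, ← LinearPMap.map_add]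
    exact congrArg A.op (Subtype.ext hu)
  refine ⟨hmem, a • w₁ + b • w₂, fun ρ => a • c₁ ρ + b • c₂ ρ, ?_, ?_, ?_, ?_, ?_, ?_⟩
  · exact IsWeakDeriv.lin a b (L2.integrableOn hξ _) (L2.integrableOn hξ _)
      (L2.integrableOn hξ _) (L2.integrableOn hξ _) hw₁ hw₂ (L2.coe_lin hξ a b _ _)
      (L2.coe_lin hξ a b _ _)
  · exact IsContRepr.lin a b hc₁ hc₂ (L2.coe_lin hξ a b _ _)
  · change a • c₁ 0 + b • c₂ 0 = B.adjoint (a • x₁.v + b • x₂.v)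
    rw [hb₁, hb₂, map_add, map_smul, map_smul]
  · change A.incl (a • y₁.u + b • y₂.u) = a • x₁.v + b • x₂.v
    rw [map_add, map_smul, map_smul, e₁, e₂]
  · change a • y₁.v + b • y₂.v = _
    rw [hop, f₁, f₂, map_add, map_smul, map_smul]
    simp only [smul_sub, smul_neg, smul_add, smul_comm μ]
    abel
  · change a • y₁.z + b • y₂.z = _
    rw [g₁, g₂]
    simp only [smul_neg, smul_add, smul_comm T₀⁻¹, neg_add]

lemma GenRel.zero (hξ : 0 < ξ) : GenRel A B μ T₀ ξ 0 0 := by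
  have hmem : A.incl (0 : Hg A U ξ).u ∈ A.op.domain := by
    change A.incl 0 ∈ _
    rw [map_zero]; exact A.op.domain.zero_mem
  have hop : A.op ⟨A.incl (0 : Hg A U ξ).u, hmem⟩ = 0 := by
    rw [← LinearPMap.map_zero A.op]
    exact congrArg A.op (Subtype.ext (map_zero A.incl))
  have hz : ((0 : L2 U ξ) : ℝ → U) =ᵐ[volume.restrict (Ioo 0 1)] 0 :=
    (absCont hξ).ae_le (Lp.coeFn_zero _ _ _)
  refine ⟨hmem, 0, 0, fun φ _ _ _ => ?_, ⟨continuousOn_const, hz⟩, ?_, ?_, ?_, ?_⟩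
  · have e : ∀ ψ : ℝ → ℝ, ∫ ρ in Ioo (0 : ℝ) 1, ψ ρ • (0 : L2 U ξ) ρ = 0 := fun ψ => by
      refine integral_eq_zero_of_ae (hz.mono fun ρ hρ => ?_)
      change ψ ρ • (0 : L2 U ξ) ρ = 0
      rw [hρ]; simp
    change ∫ ρ in Ioo (0 : ℝ) 1, deriv φ ρ • (0 : L2 U ξ) ρ = _
    rw [e, e, neg_zero]
  · change (0 : U) = B.adjoint 0
    rw [map_zero]
  · exact map_zero A.incl
  · rw [hop]
    change (0 : H) = - 0 - μ • B 0
    simp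
  · change (0 : L2 U ξ) = _
    simp

lemma GenRel.eq_zero (hξ : 0 < ξ) {y : Hg A U ξ} (h : GenRel A B μ T₀ ξ 0 y) : y = 0 := by
  obtain ⟨hmem, w, c, hw, hc, hb, e, f, g⟩ := h
  have hop : A.op ⟨A.incl (0 : Hg A U ξ).u, hmem⟩ = 0 := by
    rw [← LinearPMap.map_zero A.op]
    exact congrArg A.op (Subtype.ext (map_zero A.incl))
  have hz : ((0 : L2 U ξ) : ℝ → U) =ᵐ[volume.restrict (Ioo 0 1)] 0 :=
    (absCont hξ).ae_le (Lp.coeFn_zero _ _ _)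
  have hu : y.u = 0 := by
    refine Subtype.ext ?_
    exact e
  have hc1 : c 1 = 0 := by
    have h0 : c =ᵐ[volume.restrict (Icc (0 : ℝ) 1)] fun _ => (0 : U) := by
      rw [← restrict_Ioo_eq_restrict_Icc]
      exact hc.2.symm.trans hz
    exact Measure.eqOn_Icc_of_ae_eq volume zero_ne_one h0 hc.1 continuousOn_const
      (right_mem_Icc.mpr zero_le_one)
  have hw0 : w = 0 := by
    have h1 : ∀ᵐ ρ, ρ ∈ Ioo (0 : ℝ) 1 → w ρ = 0 := by
      refine isOpen_Ioo.ae_eq_zero_of_integral_contDiff_smul_eq_zero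
        (L2.integrableOn hξ w).locallyIntegrableOn fun φ h1 h2 h3 => ?_
      have h4 := hw φ h1 h2 h3
      have h5 : ∫ ρ in Ioo (0 : ℝ) 1, deriv φ ρ • (0 : Hg A U ξ).z ρ = 0 :=
        integral_eq_zero_of_ae (hz.mono fun ρ hρ => by
          change deriv φ ρ • (0 : L2 U ξ) ρ = 0
          rw [hρ]; simp)
      rw [h5, zero_eq_neg] at h4
      rw [← h4, setIntegral_eq_integral_of_forall_compl_eq_zero]
      intro ρ hρ
      rw [image_eq_zero_of_notMem_tsupport fun h => hρ (h3 h), zero_smul]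
    rw [Lp.eq_zero_iff_ae_eq_zero]
    exact Measure.smul_absolutelyContinuous.ae_le ((ae_restrict_iff' measurableSet_Ioo).mpr h1)
  have hv : y.v = 0 := by rw [f, hop, hc1]; simp
  have hz' : y.z = 0 := by rw [g, hw0]; simp
  change Hg.mk y.u y.v y.z = Hg.mk 0 0 0
  rw [hu, hv, hz']

end Facts

/-- The graph of `A_g`. -/
def genGraph (A : PosInvOp H) (B : U →L[ℂ] H) (μ T₀ : ℝ) {ξ : ℝ} (hξ : 0 < ξ) :
    Submodule ℂ (Hg A U ξ × Hg A U ξ) where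
  carrier := {p | GenRel A B μ T₀ ξ p.1 p.2}
  zero_mem' := GenRel.zero hξ
  add_mem' {p q} hp hq := by simpa using GenRel.lin hξ 1 1 hp hq
  smul_mem' a p hp := by simpa using GenRel.lin hξ a 0 hp (GenRel.zero hξ)

/-- The operator `A_g (u, v, z) = (v, -A u - μ B z(1), -T₀⁻¹ z_ρ)` in `Hg`, with domain
`{(u, v, z) ∈ H_1 × H_{1/2} × H¹(0,1;U) : B^* v = z(0)}`. -/
def Ag (A : PosInvOp H) (B : U →L[ℂ] H) (μ T₀ : ℝ) {ξ : ℝ} (hξ : 0 < ξ) :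
    Hg A U ξ →ₗ.[ℂ] Hg A U ξ :=
  (genGraph A B μ T₀ hξ).toLinearPMap

lemma mem_Ag_graph {A : PosInvOp H} {B : U →L[ℂ] H} {μ T₀ ξ : ℝ} (hξ : 0 < ξ)
    {x y : Hg A U ξ} : (x, y) ∈ (Ag A B μ T₀ hξ).graph ↔ GenRel A B μ T₀ ξ x y := by
  rw [Ag, Submodule.toLinearPMap_graph_eq]
  · exact Iff.rfl
  · rintro ⟨x, y⟩ hp rfl
    exact GenRel.eq_zero hξ hp

/-- `u : [0,∞) → H` is a twice continuously differentiable solution, with `u̇ = v`, of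
`ü + A u = 0` on `[0, T₀]`, `ü(t) + A u(t) + μ B B^* u̇(t - T₀) = 0` for `t ≥ T₀`, `u(0) = u₀`,
`u̇(0) = u₁`. -/
def IsDelaySolution (A : PosInvOp H) (B : U →L[ℂ] H) (μ T₀ : ℝ) (u₀ u₁ : H) (u v : ℝ → H) :
    Prop :=
  u 0 = u₀ ∧ v 0 = u₁ ∧ (∀ t, 0 ≤ t → HasDerivWithinAt u (v t) (Ici 0) t) ∧
    ∃ a : ℝ → H, ContinuousOn a (Ici 0) ∧ (∀ t, 0 ≤ t → HasDerivWithinAt v (a t) (Ici 0) t) ∧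
      ∀ t, 0 ≤ t → ∃ h : u t ∈ A.op.domain,
        (t ≤ T₀ → a t + A.op ⟨u t, h⟩ = 0) ∧
        (T₀ ≤ t → a t + A.op ⟨u t, h⟩ + μ • B (B.adjoint (v (t - T₀))) = 0)

end Generator

end DelayWave

end

noncomputable section

open Set MeasureTheory Filter Topology
open scoped InnerProductSpace ContDiff
set_option linter.unusedSectionVars false

namespace DelayWave

/-! ### Energy estimates, resolvents and uniqueness of mild solutions for dissipative operators -/

section AbstractEvolution

variable {E : Type*} [NormedAddCommGroup E] [InnerProductSpace ℂ E]

/-! The delay is turned into a state variable: the history z(ρ,t) = B^*u̇(t - T₀ρ) is transported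
along ρ, so (D) becomes the first-order problem (C) without delay.

Dissipativity (`GenRel.re_inner_le`). In Re⟨x, A_g x⟩ the two wave terms ⟨Au, v⟩ cancel. What
remains is the feedback term -μ Re⟨B^*v, z(1)⟩ and the boundary term -(ξ/2T₀)(‖z(1)‖² - ‖B^*v‖²) of
the transport part. Young's inequality and |μ| ≤ ξ/T₀ absorb z(1), leaving c‖v‖² at most. Range
(`GenRel.exists_resolvent`). Solving the transport equation explicitly and eliminating v reduces the
resolvent equation to Au + Mu = r, where M = l² + lμe^{-lT₀}BB^* is positive for l > c; conjugation
by A^{-1/2} makes it an equation (1 + P)y = r' with P ≥ 0 bounded.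

Maximal dissipativity gives well-posedness by the Hilbert space form of the Hille–Yosida theorem,
proved here through Yosida approximations (`exists_mild_of_mem_domain`, `exists_mild`). Uniqueness
(`mild_eqOn`) is an energy estimate for the primitive of a difference. Initial data in the domain
give classical solutions by integrating the mild solution that starts at G x₀
(`isClassicalSolution_of_mild`).

For the history (`delay_history`), the difference between z and the delayed trace of B^*v has a
primitive with zero trace at ρ = 0, so its norm cannot grow from zero. The trace at ρ = 1 is then
B^*u̇(t - T₀), which gives (D). Uniqueness for (D) (`IsDelaySolution.eqOn`) is the method of steps:
on each new interval of length T₀ the delay terms of two solutions already agree. -/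

lemma re_inner_le_of_bound {x y : E} {a b : ℝ} (hx : ‖x‖ ≤ a) (hy : ‖y‖ ≤ b) :
    (⟪x, y⟫_ℂ).re ≤ a * b :=
  (re_inner_le_norm (𝕜 := ℂ) x y).trans
    (mul_le_mul hx hy (norm_nonneg _) ((norm_nonneg _).trans hx))

lemma hasDerivWithinAt_norm_sq {f : ℝ → E} {g : E} {s : Set ℝ} {t : ℝ}
    (hf : HasDerivWithinAt f g s t) :
    HasDerivWithinAt (fun t => ‖f t‖ ^ 2) (2 * (⟪f t, g⟫_ℂ).re) s t := by
  let : InnerProductSpace ℝ E := InnerProductSpace.rclikeToReal ℂ E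
  exact hf.norm_sq

/-- Grönwall: e^{-2cs}‖f(s)‖² - 2εs is nonincreasing, since e^{-2cs} ≤ 1. The slack ε is for
comparing two Yosida approximations; elsewhere it is 0. -/
lemma norm_sq_le_of_re_inner_deriv_le {f g : ℝ → E} {c ε T : ℝ} (hc : 0 ≤ c) (hε : 0 ≤ ε)
    (hf : ∀ t ∈ Icc 0 T, HasDerivWithinAt f (g t) (Icc 0 T) t)
    (hd : ∀ t ∈ Icc 0 T, (⟪f t, g t⟫_ℂ).re ≤ c * ‖f t‖ ^ 2 + ε) {t : ℝ} (ht : t ∈ Icc 0 T) :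
    ‖f t‖ ^ 2 ≤ Real.exp (2 * c * t) * (‖f 0‖ ^ 2 + 2 * ε * t) := by
  have hexp : ∀ s : ℝ, HasDerivAt (fun s => Real.exp (-(2 * c * s)))
      (Real.exp (-(2 * c * s)) * -(2 * c)) s := fun s => by
    have := ((hasDerivAt_id s).const_mul (2 * c)).neg.exp
    simpa using this
  have hder : ∀ s ∈ Icc 0 T, HasDerivWithinAt
      (fun s => Real.exp (-(2 * c * s)) * ‖f s‖ ^ 2 - 2 * ε * s)
      (Real.exp (-(2 * c * s)) * -(2 * c) * ‖f s‖ ^ 2 +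
        Real.exp (-(2 * c * s)) * (2 * (⟪f s, g s⟫_ℂ).re) - 2 * ε) (Icc 0 T) s := fun s hs => by
    have h1 := (hexp s).hasDerivWithinAt (s := Icc 0 T)
    have h2 := h1.fun_mul (hasDerivWithinAt_norm_sq (hf s hs))
    have h3 := h2.fun_sub ((hasDerivWithinAt_id s (Icc 0 T)).const_mul (2 * ε))
    simpa using h3
  have hanti : AntitoneOn (fun s => Real.exp (-(2 * c * s)) * ‖f s‖ ^ 2 - 2 * ε * s)
      (Icc 0 T) := by
    refine antitoneOn_of_hasDerivWithinAt_nonpos (convex_Icc 0 T)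
      (fun s hs => (hder s hs).continuousWithinAt)
      (fun s hs => (hder s (interior_subset hs)).mono interior_subset) fun s hs => ?_
    have hs' := interior_subset hs
    have h1 := hd s hs'
    have h3 : Real.exp (-(2 * c * s)) ≤ 1 := Real.exp_le_one_iff.mpr (by
      have := mul_nonneg hc hs'.1
      nlinarith)
    have h4 := Real.exp_pos (-(2 * c * s))
    have h5 := mul_le_mul_of_nonneg_left h1 h4.le
    nlinarith
  have h := hanti (left_mem_Icc.mpr (ht.1.trans ht.2)) ht ht.1
  simp only [mul_zero, neg_zero, Real.exp_zero, one_mul, sub_zero] at h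
  have h1 : Real.exp (2 * c * t) * Real.exp (-(2 * c * t)) = 1 := by
    rw [← Real.exp_add, add_neg_cancel, Real.exp_zero]
  calc ‖f t‖ ^ 2 = Real.exp (2 * c * t) * (Real.exp (-(2 * c * t)) * ‖f t‖ ^ 2) := by
        rw [← mul_assoc, h1, one_mul]
    _ ≤ _ := mul_le_mul_of_nonneg_left (by linarith) (Real.exp_pos _).le

lemma hasDerivWithinAt_integral_Ici {F : Type*} [NormedAddCommGroup F] [NormedSpace ℝ F]
    [CompleteSpace F] {f : ℝ → F} (hf : ContinuousOn f (Ici 0)) {t : ℝ} (ht : 0 ≤ t) :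
    HasDerivWithinAt (fun t => ∫ s in (0 : ℝ)..t, f s) (f t) (Ici 0) t := by
  have hc : Continuous fun s => f (max s 0) :=
    hf.comp_continuous (by fun_prop) fun s => le_max_right s 0
  have h := (intervalIntegral.integral_hasDerivAt_right (hc.intervalIntegrable 0 t)
    hc.stronglyMeasurable.stronglyMeasurableAtFilter hc.continuousAt).hasDerivWithinAt (s := Ici 0)
  rw [max_eq_left ht] at h
  have he : ∀ x ∈ Ici (0 : ℝ), (∫ s in (0 : ℝ)..x, f s) = ∫ s in (0 : ℝ)..x, f (max s 0) := by
    intro x hx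
    refine intervalIntegral.integral_congr fun s hs => ?_
    rw [uIcc_of_le hx] at hs
    simp only [max_eq_left hs.1]
  exact h.congr he (he t ht)

lemma ContinuousOn.intervalIntegrable_Ici {F : Type*} [NormedAddCommGroup F]
    {f : ℝ → F} (hf : ContinuousOn f (Ici 0)) {a b : ℝ} (ha : 0 ≤ a) (hb : 0 ≤ b) :
    IntervalIntegrable f volume a b :=
  (hf.mono fun _ hx => (le_min ha hb).trans hx.1).intervalIntegrable

lemma exists_limit_of_uniformCauchySeqOn [CompleteSpace E] {X : ℕ → ℝ → E}
    (hX : ∀ n, ContinuousOn (X n) (Ici 0))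
    (h : ∀ T, UniformCauchySeqOn X atTop (Icc 0 T)) :
    ∃ Y : ℝ → E, ContinuousOn Y (Ici 0) ∧ ∀ t, 0 ≤ t →
      Tendsto (fun n => X n t) atTop (𝓝 (Y t)) ∧
      Tendsto (fun n => ∫ s in (0 : ℝ)..t, X n s) atTop (𝓝 (∫ s in (0 : ℝ)..t, Y s)) := by
  have hlim : ∀ t : ℝ, ∃ y, 0 ≤ t → Tendsto (fun n => X n t) atTop (𝓝 y) := fun t => by
    by_cases ht : 0 ≤ t
    · obtain ⟨y, hy⟩ := cauchySeq_tendsto_of_complete ((h t).cauchySeq (right_mem_Icc.mpr ht))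
      exact ⟨y, fun _ => hy⟩
    · exact ⟨0, fun h => absurd h ht⟩
  choose Y hY using hlim
  have hunif : ∀ T, TendstoUniformlyOn X Y atTop (Icc 0 T) := fun T =>
    (h T).tendstoUniformlyOn_of_tendsto fun t ht => hY t ht.1
  have hcont : ∀ T, ContinuousOn Y (Icc 0 T) := fun T =>
    (hunif T).continuousOn (Frequently.of_forall fun n => (hX n).mono Icc_subset_Ici_self)
  refine ⟨Y, fun t ht => ?_, fun t ht => ⟨hY t ht, ?_⟩⟩
  · have h1 := hcont (t + 1) t ⟨ht, by linarith⟩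
    refine h1.mono_of_mem_nhdsWithin ?_
    rw [← Ici_inter_Iic]
    exact inter_mem_nhdsWithin _ (Iic_mem_nhds (by linarith))
  · refine TendstoUniformlyOn.tendsto_intervalIntegral_of_continuousOn
      (Eventually.of_forall fun n => ?_) ?_
    · rw [uIcc_of_le ht]; exact (hX n).mono Icc_subset_Ici_self
    · rw [uIcc_of_le ht]; exact hunif t

lemma exists_hasDerivAt_eq_clm [CompleteSpace E] (T : E →L[ℂ] E) (x₀ : E) :
    ∃ x : ℝ → E, x 0 = x₀ ∧ ∀ t, HasDerivAt x (T (x t)) t := by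
  refine ⟨fun t => NormedSpace.exp ((t : ℂ) • T) x₀, by simp, fun t => ?_⟩
  have h := (hasDerivAt_exp_smul_const' T (t : ℂ)).scomp t Complex.ofRealCLM.hasDerivAt
  have h2 := ((ContinuousLinearMap.apply ℂ E x₀).restrictScalars ℝ).hasFDerivAt.comp_hasDerivAt t h
  simpa [Function.comp_def] using h2

variable {G : E →ₗ.[ℂ] E} {c : ℝ}

lemma re_inner_graph_le (hG : IsMaximalDissipativeShift G c) {x y : E}
    (h : (x, y) ∈ G.graph) : (⟪x, y⟫_ℂ).re ≤ c * ‖x‖ ^ 2 := by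
  obtain ⟨z, rfl, rfl⟩ := (LinearPMap.mem_graph_iff G).mp h
  have h1 := hG.1 z
  have h2 : (⟪(z : E), (z : E)⟫_ℂ).re = ‖(z : E)‖ ^ 2 := inner_self_eq_norm_sq (𝕜 := ℂ) (z : E)
  rw [inner_sub_right, inner_smul_right_eq_smul, Complex.sub_re, Complex.smul_re, h2,
    smul_eq_mul] at h1
  linarith

/-- Pairing (l - (G - c))x with x and using dissipativity gives l‖x‖² ≤ ‖x‖‖(l - (G - c))x‖, hence
injectivity and the bound on the inverse R. The second clause encodes membership in the graph of the
unbounded G as an equation for the bounded R, so closedness of the graph and its compatibility with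
integrals become statements about R. -/
lemma exists_resolvent (hG : IsMaximalDissipativeShift G c) {l : ℝ} (hl : 0 < l) :
    ∃ R : E →L[ℂ] E, (∀ y, ‖R y‖ ≤ l⁻¹ * ‖y‖) ∧
      ∀ x y, (x, y) ∈ G.graph ↔ R (l • x - (y - c • x)) = x := by
  let F : G.domain →ₗ[ℂ] E := ((l + c : ℝ) : ℂ) • G.domain.subtype - G.toFun
  have hF : ∀ x, F x = l • (x : E) - (G x - c • (x : E)) := fun x => by
    change ((l + c : ℝ) : ℂ) • (x : E) - G x = _
    rw [Complex.coe_smul, add_smul]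
    abel
  have hbound : ∀ x : G.domain, ‖(x : E)‖ ≤ l⁻¹ * ‖F x‖ := fun x => by
    have h1 := hG.1 x
    have h2 := re_inner_le_norm (𝕜 := ℂ) (x : E) (F x)
    have h3 : (⟪(x : E), (x : E)⟫_ℂ).re = ‖(x : E)‖ ^ 2 := inner_self_eq_norm_sq (𝕜 := ℂ) (x : E)
    have h4 : (⟪(x : E), F x⟫_ℂ).re = l * ‖(x : E)‖ ^ 2 -
        (⟪(x : E), G x - c • (x : E)⟫_ℂ).re := by
      rw [hF, inner_sub_right, inner_smul_right_eq_smul, Complex.sub_re, Complex.smul_re, h3,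
        smul_eq_mul]
    have h5 : l * ‖(x : E)‖ ^ 2 ≤ ‖(x : E)‖ * ‖F x‖ := by
      have : (⟪(x : E), F x⟫_ℂ).re ≤ ‖(x : E)‖ * ‖F x‖ := h2
      linarith
    rw [inv_mul_eq_div, le_div_iff₀ hl]
    rcases (norm_nonneg (x : E)).eq_or_lt with h | h
    · rw [← h, zero_mul]; exact norm_nonneg _
    · nlinarith
  have hinj : Function.Injective F := by
    rw [injective_iff_map_eq_zero]
    intro x hx
    have := hbound x
    rw [hx, norm_zero, mul_zero] at this
    exact Subtype.ext (norm_le_zero_iff.mp this)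
  have hsurj : Function.Surjective F := fun y => by
    obtain ⟨x, hx⟩ := hG.2 l hl y
    exact ⟨x, (hF x).trans hx⟩
  let e := LinearEquiv.ofBijective F ⟨hinj, hsurj⟩
  have he : ∀ y, F (e.symm y) = y := e.apply_symm_apply
  refine ⟨LinearMap.mkContinuous (G.domain.subtype ∘ₗ e.symm.toLinearMap) l⁻¹ fun y => ?_,
    fun y => ?_, fun x y => ⟨fun h => ?_, fun h => ?_⟩⟩
  · have := hbound (e.symm y)
    rwa [he] at this
  · have := hbound (e.symm y)
    rwa [he] at this
  · obtain ⟨z, rfl, rfl⟩ := (LinearPMap.mem_graph_iff G).mp h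
    rw [← hF]
    change ((e.symm (e z) : G.domain) : E) = z
    rw [e.symm_apply_apply]
  · change ((e.symm (l • x - (y - c • x)) : G.domain) : E) = x at h
    have h1 := he (l • x - (y - c • x))
    rw [hF, h, sub_right_inj, sub_left_inj] at h1
    exact (LinearPMap.mem_graph_iff G).mpr ⟨_, h, h1⟩

lemma graph_isClosed (hG : IsMaximalDissipativeShift G c) : IsClosed (G.graph : Set (E × E)) := by
  obtain ⟨R, -, hR⟩ := exists_resolvent hG one_pos
  have : (G.graph : Set (E × E)) = {p | R ((1 : ℝ) • p.1 - (p.2 - c • p.1)) = p.1} := by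
    ext ⟨x, y⟩
    exact hR x y
  rw [this]
  exact isClosed_eq (by fun_prop) continuous_fst

lemma mem_graph_iff_exists {x y : E} : (x, y) ∈ G.graph ↔ ∃ h : x ∈ G.domain, G ⟨x, h⟩ = y := by
  rw [LinearPMap.mem_graph_iff]
  constructor
  · rintro ⟨z, rfl, rfl⟩
    exact ⟨z.2, rfl⟩
  · rintro ⟨h, rfl⟩
    exact ⟨⟨x, h⟩, rfl, rfl⟩

lemma isMildSolution_iff {x₀ : E} {X : ℝ → E} : IsMildSolution G x₀ X ↔ ContinuousOn X (Ici 0) ∧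
    ∀ t, 0 ≤ t → ((∫ s in (0 : ℝ)..t, X s), X t - x₀) ∈ G.graph := by
  refine and_congr_right fun _ => forall₂_congr fun t ht => ?_
  rw [mem_graph_iff_exists]
  refine exists_congr fun h => ?_
  rw [eq_sub_iff_add_eq', eq_comm]

/-- The primitive f of X - Y satisfies f' = G f and f(0) = 0, so the energy estimate gives f = 0;
then X - Y = G f = 0. Working with the primitive is necessary because X and Y need not lie in the
domain. -/
lemma mild_eqOn [CompleteSpace E] (hc : 0 ≤ c) (hG : IsMaximalDissipativeShift G c) {x₀ : E}
    {X Y : ℝ → E} (hX : IsMildSolution G x₀ X) (hY : IsMildSolution G x₀ Y) :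
    EqOn X Y (Ici 0) := by
  rw [isMildSolution_iff] at hX hY
  have hsub : ContinuousOn (fun s => X s - Y s) (Ici 0) := hX.1.sub hY.1
  have key : ∀ t, 0 ≤ t → (∫ s in (0 : ℝ)..t, (X s - Y s), X t - Y t) ∈ G.graph := fun t ht => by
    have h := G.graph.sub_mem (hX.2 t ht) (hY.2 t ht)
    rw [Prod.mk_sub_mk, sub_sub_sub_cancel_right, ← intervalIntegral.integral_sub
      (ContinuousOn.intervalIntegrable_Ici hX.1 le_rfl ht)
      (ContinuousOn.intervalIntegrable_Ici hY.1 le_rfl ht)] at h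
    exact h
  intro t ht
  have h0 : (∫ s in (0 : ℝ)..t, (X s - Y s)) = 0 := by
    have h := norm_sq_le_of_re_inner_deriv_le (f := fun t => ∫ s in (0 : ℝ)..t, (X s - Y s))
      (g := fun s => X s - Y s) (T := t) hc le_rfl
      (fun s hs => (hasDerivWithinAt_integral_Ici hsub hs.1).mono Icc_subset_Ici_self)
      (fun s hs => by simpa using re_inner_graph_le hG (key s hs.1)) (right_mem_Icc.mpr ht)
    simp only [intervalIntegral.integral_same, norm_zero] at h
    have h2 : ‖∫ s in (0 : ℝ)..t, (X s - Y s)‖ ^ 2 ≤ 0 := by simpa using h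
    simpa [Function.comp_def] using h2
  have h1 := key t ht
  rw [h0] at h1
  exact sub_eq_zero.mp (G.graph_fst_eq_zero_snd h1 rfl)

/-- Limits of mild solutions whose initial values converge are mild solutions. -/
lemma exists_mild_of_tendsto [CompleteSpace E] (hc : 0 ≤ c) (hG : IsMaximalDissipativeShift G c)
    {x : ℕ → E} {x₀ : E} (hx : Tendsto x atTop (𝓝 x₀)) {X : ℕ → ℝ → E}
    (hX : ∀ n, IsMildSolution G (x n) (X n))
    (hbd : ∀ n m t, 0 ≤ t → ‖X n t - X m t‖ ≤ Real.exp (c * t) * ‖x n - x m‖) :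
    ∃ Y, IsMildSolution G x₀ Y := by
  have hcau : ∀ T, UniformCauchySeqOn X atTop (Icc 0 T) := fun T => by
    rw [Metric.uniformCauchySeqOn_iff]
    intro ε hε
    obtain ⟨N, hN⟩ := Metric.cauchySeq_iff.mp hx.cauchySeq (ε / Real.exp (c * T))
      (div_pos hε (Real.exp_pos _))
    refine ⟨N, fun m hm n hn t ht => ?_⟩
    have h1 := hN m hm n hn
    rw [dist_eq_norm, lt_div_iff₀ (Real.exp_pos _)] at h1
    rw [dist_eq_norm]
    have h2 : Real.exp (c * t) ≤ Real.exp (c * T) :=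
      Real.exp_le_exp.mpr (mul_le_mul_of_nonneg_left ht.2 hc)
    have h3 := mul_le_mul_of_nonneg_right h2 (norm_nonneg (x m - x n))
    linarith [hbd m n t ht.1]
  obtain ⟨Y, hY, hlim⟩ := exists_limit_of_uniformCauchySeqOn
    (fun n => (isMildSolution_iff.mp (hX n)).1) hcau
  refine ⟨Y, isMildSolution_iff.mpr ⟨hY, fun t ht => ?_⟩⟩
  exact (graph_isClosed hG).mem_of_tendsto
    ((hlim t ht).2.prodMk_nhds ((hlim t ht).1.sub hx))
    (Eventually.of_forall fun n => (isMildSolution_iff.mp (hX n)).2 t ht)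

end AbstractEvolution

/-! ### Existence of mild and classical solutions by Yosida approximation -/

section HilleYosida

variable {E : Type*} [NormedAddCommGroup E] [InnerProductSpace ℂ E]
variable {G : E →ₗ.[ℂ] E} {c : ℝ}

/-- The Yosida approximation `K = (G - c) J` of `G - c`, where `J = (1 - l⁻¹ (G - c))⁻¹`. -/
lemma exists_yosida (hG : IsMaximalDissipativeShift G c) {l : ℝ} (hl : 0 < l) :
    ∃ J K : E →L[ℂ] E, (∀ y, (J y, K y + c • J y) ∈ G.graph) ∧
      (∀ y, y = J y - l⁻¹ • K y) ∧
      ∀ x y, (x, y) ∈ G.graph → ‖K x‖ ≤ ‖y - c • x‖ := by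
  obtain ⟨R, hR, hgr⟩ := exists_resolvent hG hl
  -- With J = lR and K = l(J - 1), J y differs from y by K y / l. On the graph, K x = J(y - c x) and
  -- J is a contraction, which bounds K x independently of l.
  refine ⟨(l : ℂ) • R, (l : ℂ) • ((l : ℂ) • R - 1), fun y => ?_, fun y => ?_, fun x y h => ?_⟩
  · rw [hgr]
    have : l • ((l : ℂ) • R) y - (((l : ℂ) • ((l : ℂ) • R - 1)) y + c • ((l : ℂ) • R) y -
        c • ((l : ℂ) • R) y) = (l : ℂ) • y := by
      simp only [smul_apply, sub_apply,
        one_apply_eq_self, smul_sub, Complex.coe_smul]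
      abel
    rw [this, map_smul]
    rfl
  · simp only [smul_apply, sub_apply,
        one_apply_eq_self, Complex.coe_smul, smul_smul, inv_mul_cancel₀ hl.ne', one_smul]
    abel
  · have h1 := (hgr x y).mp h
    have h2 : ((l : ℂ) • ((l : ℂ) • R - 1)) x = l • R (y - c • x) := by
      rw [map_sub, ← Complex.coe_smul l x, map_smul, sub_eq_iff_eq_add] at h1
      simp only [smul_apply, sub_apply,
        one_apply_eq_self]
      rw [h1, add_sub_cancel_left, Complex.coe_smul]
    rw [h2, norm_smul, Real.norm_of_nonneg hl.le]
    calc l * ‖R (y - c • x)‖ ≤ l * (l⁻¹ * ‖y - c • x‖) := mul_le_mul_of_nonneg_left (hR _) hl.le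
      _ = _ := by rw [← mul_assoc, mul_inv_cancel₀ hl.ne', one_mul]

lemma re_inner_shift_le (hG : IsMaximalDissipativeShift G c) {x y : E}
    (h : (x, y + c • x) ∈ G.graph) : (⟪x, y⟫_ℂ).re ≤ 0 := by
  obtain ⟨z, rfl, hz⟩ := (LinearPMap.mem_graph_iff G).mp h
  have h1 := hG.1 z
  rwa [hz, add_sub_cancel_right] at h1

lemma norm_le_of_re_inner_deriv_le {f g : ℝ → E} {c : ℝ} (hc : 0 ≤ c)
    (hf : ∀ t, 0 ≤ t → HasDerivWithinAt f (g t) (Ici 0) t)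
    (hd : ∀ t, 0 ≤ t → (⟪f t, g t⟫_ℂ).re ≤ c * ‖f t‖ ^ 2) {t : ℝ} (ht : 0 ≤ t) :
    ‖f t‖ ≤ Real.exp (c * t) * ‖f 0‖ := by
  have h := norm_sq_le_of_re_inner_deriv_le hc le_rfl
    (fun s hs => (hf s hs.1).mono Icc_subset_Ici_self) (fun s hs => by simpa using hd s hs.1)
    (right_mem_Icc.mpr ht)
  refine le_of_sq_le_sq (h.trans_eq ?_) (by positivity)
  rw [mul_pow, ← Real.exp_nat_mul]
  simp [mul_assoc]

/-- The bounded problems x_n' = (K_n + c)x_n converge uniformly on compact intervals. Dissipativity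
holds for J_n x_n - J_m x_m rather than for x_n - x_m, but the two differ by O(1/n + 1/m) because
K_n x_n stays bounded when x₀ is in the domain. This inner product argument needs no data in the
domain of G². -/
lemma exists_mild_of_mem_domain [CompleteSpace E] (hc : 0 ≤ c)
    (hG : IsMaximalDissipativeShift G c) {x₀ y₀ : E} (h₀ : (x₀, y₀) ∈ G.graph) :
    ∃ X, IsMildSolution G x₀ X ∧ ∀ t, 0 ≤ t → ‖X t‖ ≤ Real.exp (c * t) * ‖x₀‖ := by
  have hpos : ∀ n : ℕ, (0 : ℝ) < n + 1 := fun n => by positivity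
  choose J K hJK hid hK using fun n : ℕ => exists_yosida hG (hpos n)
  choose x hx0 hx using fun n => exists_hasDerivAt_eq_clm (K n + (c : ℂ) • 1) x₀
  have hx' : ∀ n t, HasDerivAt (x n) (K n (x n t) + c • x n t) t := fun n t => by
    simpa using hx n t
  have hdiss : ∀ n y, (⟪y, K n y⟫_ℂ).re ≤ 0 := fun n y => by
    have h1 := re_inner_shift_le hG (hJK n y)
    have h2 : (⟪y, K n y⟫_ℂ).re = (⟪J n y, K n y⟫_ℂ).re - ((n : ℝ) + 1)⁻¹ * ‖K n y‖ ^ 2 := by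
      have h3 : (⟪K n y, K n y⟫_ℂ).re = ‖K n y‖ ^ 2 := inner_self_eq_norm_sq (𝕜 := ℂ) (K n y)
      rw [congrArg (fun z => ⟪z, K n y⟫_ℂ) (hid n y), inner_sub_left, inner_smul_left_eq_smul,
        Complex.sub_re, Complex.smul_re, h3, smul_eq_mul]
    have h3 : 0 ≤ ((n : ℝ) + 1)⁻¹ * ‖K n y‖ ^ 2 := by positivity
    linarith
  set M := ‖y₀ - c • x₀‖
  have hself : ∀ y : E, (⟪y, c • y⟫_ℂ).re = c * ‖y‖ ^ 2 := fun y => by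
    rw [inner_smul_right_eq_smul, Complex.smul_re, smul_eq_mul]
    exact congrArg (c * ·) (inner_self_eq_norm_sq (𝕜 := ℂ) y)
  -- K_n commutes with K_n + c, so K_n x_n solves the same equation as x_n, with initial value
  -- bounded by M.
  have hKx : ∀ n t, 0 ≤ t → ‖K n (x n t)‖ ≤ Real.exp (c * t) * M := fun n t ht => by
    have h1 := norm_le_of_re_inner_deriv_le (f := fun t => K n (x n t))
      (g := fun t => K n (K n (x n t)) + c • K n (x n t)) hc
      (fun s _ => by
        have := ((K n).restrictScalars ℝ).hasFDerivAt.comp_hasDerivAt s (hx' n s)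
        simp only [ContinuousLinearMap.coe_restrictScalars', map_add] at this
        rw [← Complex.coe_smul c (x n s), map_smul, Complex.coe_smul] at this
        exact this.hasDerivWithinAt)
      (fun s _ => by
        rw [inner_add_right, Complex.add_re, hself]
        linarith [hdiss n (K n (x n s))]) ht
    rw [hx0] at h1
    exact h1.trans (mul_le_mul_of_nonneg_left (hK n _ _ h₀) (Real.exp_pos _).le)
  have hdiff : ∀ n m T t, t ∈ Icc 0 T → ‖x n t - x m t‖ ^ 2 ≤ Real.exp (2 * c * t) *
      (2 * (((((n : ℝ) + 1)⁻¹ + ((m : ℝ) + 1)⁻¹)) * (2 * (Real.exp (c * T) * M) ^ 2)) * t) := by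
    intro n m T t ht
    set Q := Real.exp (c * T) * M
    have hQ : ∀ n s, s ∈ Icc 0 T → ‖K n (x n s)‖ ≤ Q := fun n s hs =>
      (hKx n s hs.1).trans (mul_le_mul_of_nonneg_right
        (Real.exp_le_exp.mpr (mul_le_mul_of_nonneg_left hs.2 hc)) (norm_nonneg _))
    have h := norm_sq_le_of_re_inner_deriv_le (f := fun t => x n t - x m t)
      (g := fun t => (K n (x n t) + c • x n t) - (K m (x m t) + c • x m t)) (T := T)
      (ε := (((n : ℝ) + 1)⁻¹ + ((m : ℝ) + 1)⁻¹) * (2 * Q ^ 2)) hc (by positivity)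
      (fun s _ => ((hx' n s).sub (hx' m s)).hasDerivWithinAt) (fun s hs => ?_) ht
    · simpa [hx0] using h
    · set a := K n (x n s)
      set b := K m (x m s)
      have e1 : (K n (x n s) + c • x n s) - (K m (x m s) + c • x m s) =
          (a - b) + c • (x n s - x m s) := by rw [smul_sub]; abel
      -- The first summand pairs nonpositively with a - b; the second, paired with a - b, is at most
      -- (1/(n+1) + 1/(m+1))·Q·2Q, which is the ε chosen above.
      have e2 : x n s - x m s = (J n (x n s) - J m (x m s)) +
          (((m : ℝ) + 1)⁻¹ • b - ((n : ℝ) + 1)⁻¹ • a) := by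
        conv_lhs => rw [hid n (x n s), hid m (x m s)]
        abel
      have e3 : (⟪J n (x n s) - J m (x m s), a - b⟫_ℂ).re ≤ 0 := by
        refine re_inner_shift_le hG ?_
        have := G.graph.sub_mem (hJK n (x n s)) (hJK m (x m s))
        rw [Prod.mk_sub_mk, add_sub_add_comm, ← smul_sub] at this
        exact this
      have e4 : ‖a - b‖ ≤ 2 * Q := (norm_sub_le _ _).trans (by linarith [hQ n s hs, hQ m s hs])
      have e5 : ‖((m : ℝ) + 1)⁻¹ • b - ((n : ℝ) + 1)⁻¹ • a‖ ≤
          (((n : ℝ) + 1)⁻¹ + ((m : ℝ) + 1)⁻¹) * Q := by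
        refine (norm_sub_le _ _).trans ?_
        rw [norm_smul, norm_smul, Real.norm_of_nonneg (by positivity),
          Real.norm_of_nonneg (by positivity), add_mul, add_comm]
        exact add_le_add (mul_le_mul_of_nonneg_left (hQ n s hs) (by positivity))
          (mul_le_mul_of_nonneg_left (hQ m s hs) (by positivity))
      have e6 := re_inner_le_of_bound e5 e4
      rw [e1, inner_add_right, Complex.add_re, hself]
      conv_lhs => enter [1]; rw [e2, inner_add_left, Complex.add_re]
      linarith
  have hn0 : Tendsto (fun n : ℕ => ((n : ℝ) + 1)⁻¹) atTop (𝓝 0) := by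
    simpa using tendsto_one_div_add_atTop_nhds_zero_nat (𝕜 := ℝ)
  have hcau : ∀ T, UniformCauchySeqOn x atTop (Icc 0 T) := fun T => by
    rw [Metric.uniformCauchySeqOn_iff]
    intro ε hε
    set C := Real.exp (2 * c * T) * (2 * (2 * (Real.exp (c * T) * M) ^ 2) * |T|)
    have hC : 0 ≤ C := by positivity
    have h1 : Tendsto (fun n : ℕ => C * (((n : ℝ) + 1)⁻¹ + ((n : ℝ) + 1)⁻¹)) atTop (𝓝 0) := by
      simpa using (hn0.add hn0).const_mul C
    obtain ⟨N, hN⟩ := (h1.eventually_lt_const (pow_pos hε 2)).exists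
    refine ⟨N, fun m hm n hn t ht => ?_⟩
    rw [dist_eq_norm]
    refine lt_of_pow_lt_pow_left₀ 2 hε.le (((hdiff m n T t ht).trans ?_).trans_lt hN)
    have hinv : ∀ k : ℕ, N ≤ k → ((k : ℝ) + 1)⁻¹ ≤ ((N : ℝ) + 1)⁻¹ := fun k hk =>
      inv_anti₀ (hpos N) (by simpa using hk)
    calc Real.exp (2 * c * t) * (2 * (((((m : ℝ) + 1)⁻¹ + ((n : ℝ) + 1)⁻¹)) *
          (2 * (Real.exp (c * T) * M) ^ 2)) * t)
        ≤ Real.exp (2 * c * T) * (2 * (((((N : ℝ) + 1)⁻¹ + ((N : ℝ) + 1)⁻¹)) *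
          (2 * (Real.exp (c * T) * M) ^ 2)) * |T|) := by
          have h2 := hinv m hm
          have h3 := hinv n hn
          have h4 := ht.1
          have h5 := ht.2.trans (le_abs_self T)
          gcongr
          exact ht.2
      _ = C * (((N : ℝ) + 1)⁻¹ + ((N : ℝ) + 1)⁻¹) := by ring
  obtain ⟨X, hX, hlim⟩ := exists_limit_of_uniformCauchySeqOn
    (fun n => fun t _ => (hx' n t).continuousAt.continuousWithinAt) hcau
  refine ⟨X, isMildSolution_iff.mpr ⟨hX, fun t ht => ?_⟩, fun t ht => ?_⟩
  swap
  · refine le_of_tendsto (hlim t ht).1.norm (Eventually.of_forall fun n => ?_)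
    have h1 := norm_le_of_re_inner_deriv_le hc (fun s _ => (hx' n s).hasDerivWithinAt)
      (fun s _ => by
        rw [inner_add_right, Complex.add_re, hself]
        linarith [hdiss n (x n s)]) ht
    rwa [hx0] at h1
  -- The integrated equation expresses K_n ∫x_n through convergent quantities; J_n ∫x_n then has the
  -- same limit as ∫x_n, and closedness of the graph finishes.
  have hint : ∀ n, x n t - x₀ = K n (∫ s in (0 : ℝ)..t, x n s) + c • ∫ s in (0 : ℝ)..t, x n s :=
    fun n => by
    have hcx : Continuous (x n) := continuous_iff_continuousAt.mpr fun s => (hx' n s).continuousAt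
    have hi := hcx.intervalIntegrable (μ := volume) 0 t
    rw [← hx0 n, ← intervalIntegral.integral_eq_sub_of_hasDerivAt (fun s _ => hx' n s)
      (Continuous.intervalIntegrable (by fun_prop) _ _), intervalIntegral.integral_add
      (Continuous.intervalIntegrable (by fun_prop) _ _)
      (Continuous.intervalIntegrable (by fun_prop) _ _), intervalIntegral.integral_smul,
      (K n).intervalIntegral_comp_comm hi]
  have hKlim : Tendsto (fun n => K n (∫ s in (0 : ℝ)..t, x n s)) atTop
      (𝓝 (X t - x₀ - c • ∫ s in (0 : ℝ)..t, X s)) := by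
    have h1 := ((hlim t ht).1.sub_const x₀).sub ((hlim t ht).2.const_smul c)
    refine h1.congr fun n => ?_
    rw [hint, add_sub_cancel_right]
  have hJlim : Tendsto (fun n => J n (∫ s in (0 : ℝ)..t, x n s)) atTop
      (𝓝 (∫ s in (0 : ℝ)..t, X s)) := by
    have h1 := (hlim t ht).2.add (hn0.smul hKlim)
    rw [zero_smul, add_zero] at h1
    refine h1.congr fun n => ?_
    exact eq_sub_iff_add_eq.mp (hid n _)
  have h2 := (graph_isClosed hG).mem_of_tendsto
    (hJlim.prodMk_nhds (hKlim.add (hJlim.const_smul c))) (Eventually.of_forall fun n => hJK n _)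
  rwa [sub_add_cancel] at h2

/-- Given y orthogonal to the domain, solve x - (G - c)x = y. Pairing with x yields ‖x‖² = Re⟨x, (G
- c)x⟩ ≤ 0, so x = 0 and y = 0. -/
lemma dense_domain (hG : IsMaximalDissipativeShift G c) [CompleteSpace E] :
    Dense (G.domain : Set E) := by
  rw [Submodule.dense_iff_topologicalClosure_eq_top, Submodule.topologicalClosure_eq_top_iff,
    Submodule.eq_bot_iff]
  intro y hy
  obtain ⟨x, hx⟩ := hG.2 1 one_pos y
  have h1 : (⟪(x : E), y⟫_ℂ).re = 0 := by
    rw [(Submodule.mem_orthogonal _ _).mp hy _ x.2, Complex.zero_re]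
  have h2 := hG.1 x
  have h3 : (⟪(x : E), (x : E)⟫_ℂ).re = ‖(x : E)‖ ^ 2 := inner_self_eq_norm_sq (𝕜 := ℂ) (x : E)
  rw [← hx, one_smul, inner_sub_right, Complex.sub_re, h3] at h1
  have h4 : ‖(x : E)‖ ^ 2 ≤ 0 := by linarith
  have h5 : x = 0 := Subtype.ext (by simpa using h4)
  rw [← hx, h5]
  simp

lemma IsMildSolution.sub {x₀ y₀ : E} {X Y : ℝ → E}
    (hX : IsMildSolution G x₀ X) (hY : IsMildSolution G y₀ Y) :
    IsMildSolution G (x₀ - y₀) (fun t => X t - Y t) := by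
  rw [isMildSolution_iff] at hX hY ⊢
  refine ⟨hX.1.sub hY.1, fun t ht => ?_⟩
  have h := G.graph.sub_mem (hX.2 t ht) (hY.2 t ht)
  rw [Prod.mk_sub_mk, ← intervalIntegral.integral_sub
    (ContinuousOn.intervalIntegrable_Ici hX.1 le_rfl ht)
    (ContinuousOn.intervalIntegrable_Ici hY.1 le_rfl ht), sub_sub_sub_comm] at h
  exact h

/-- Approximate x₀ from the dense domain; by uniqueness, differences of the approximating solutions
inherit the growth bound and so converge. -/
lemma exists_mild [CompleteSpace E] (hc : 0 ≤ c) (hG : IsMaximalDissipativeShift G c) (x₀ : E) :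
    ∃ X, IsMildSolution G x₀ X := by
  obtain ⟨x, hxD, hx⟩ := mem_closure_iff_seq_limit.mp (dense_domain hG x₀)
  choose X hX _ using fun n => exists_mild_of_mem_domain hc hG (G.mem_graph ⟨x n, hxD n⟩)
  refine exists_mild_of_tendsto hc hG hx hX fun n m t ht => ?_
  obtain ⟨Z, hZ, hZb⟩ := exists_mild_of_mem_domain hc hG
    (G.mem_graph (⟨x n, hxD n⟩ - ⟨x m, hxD m⟩ : G.domain))
  have he : X n t - X m t = Z t := mild_eqOn hc hG ((hX n).sub (hX m)) hZ ht
  rw [he]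
  exact hZb t ht

lemma integral_mem_graph [CompleteSpace E] (hG : IsMaximalDissipativeShift G c) {f g : ℝ → E}
    (hf : ContinuousOn f (Ici 0)) (hg : ContinuousOn g (Ici 0))
    (h : ∀ t, 0 ≤ t → (f t, g t) ∈ G.graph) {t : ℝ} (ht : 0 ≤ t) :
    (∫ s in (0 : ℝ)..t, f s, ∫ s in (0 : ℝ)..t, g s) ∈ G.graph := by
  obtain ⟨R, -, hR⟩ := exists_resolvent hG one_pos
  have hfi := ContinuousOn.intervalIntegrable_Ici hf le_rfl ht
  have hgi := ContinuousOn.intervalIntegrable_Ici hg le_rfl ht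
  have h1 : IntervalIntegrable (fun s => (1 : ℝ) • f s) volume 0 t := hfi.smul 1
  have h2 : IntervalIntegrable (fun s => c • f s) volume 0 t := hfi.smul c
  have h3 : IntervalIntegrable (fun s => g s - c • f s) volume 0 t := hgi.sub h2
  rw [hR, ← intervalIntegral.integral_smul, ← intervalIntegral.integral_smul,
    ← intervalIntegral.integral_sub hgi h2, ← intervalIntegral.integral_sub h1 h3,
    ← R.intervalIntegral_comp_comm (h1.sub h3)]
  refine intervalIntegral.integral_congr fun s hs => ?_
  rw [uIcc_of_le ht] at hs
  exact (hR _ _).mp (h s hs.1)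

/-- If Y is the mild solution starting at G x₀, then Z = x₀ + ∫Y satisfies G Z = Y = Z'. Integrating
shows that Z is also mild, so it coincides with X. -/
lemma isClassicalSolution_of_mild [CompleteSpace E] (hc : 0 ≤ c)
    (hG : IsMaximalDissipativeShift G c) {x₀ : E} (h₀ : x₀ ∈ G.domain) {X : ℝ → E}
    (hX : IsMildSolution G x₀ X) : IsClassicalSolution G x₀ X := by
  obtain ⟨Y, hY⟩ := exists_mild hc hG (G ⟨x₀, h₀⟩)
  rw [isMildSolution_iff] at hY
  set Z : ℝ → E := fun t => x₀ + ∫ s in (0 : ℝ)..t, Y s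
  have hZd : ∀ t, 0 ≤ t → HasDerivWithinAt Z (Y t) (Ici 0) t := fun t ht =>
    (hasDerivWithinAt_integral_Ici hY.1 ht).const_add x₀
  have hZc : ContinuousOn Z (Ici 0) := fun t ht => (hZd t ht).continuousWithinAt
  have hZg : ∀ t, 0 ≤ t → (Z t, Y t) ∈ G.graph := fun t ht => by
    have := G.graph.add_mem (G.mem_graph ⟨x₀, h₀⟩) (hY.2 t ht)
    rwa [Prod.mk_add_mk, add_sub_cancel] at this
  have hZ : IsMildSolution G x₀ Z := isMildSolution_iff.mpr ⟨hZc, fun t ht => by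
    rw [show Z t - x₀ = ∫ s in (0 : ℝ)..t, Y s from add_sub_cancel_left _ _]
    exact integral_mem_graph hG hZc hY.1 hZg ht⟩
  have he := mild_eqOn hc hG hX hZ
  refine ⟨?_, hZc.congr he, Y, hY.1, fun t ht => ⟨?_, ?_⟩⟩
  · rw [he self_mem_Ici]
    simp [Z]
  · rw [he ht]
    exact mem_graph_iff_exists.mp (hZg t ht)
  · exact (hZd t ht).congr he (he ht)

end HilleYosida

/-! ### Absolutely continuous vector-valued functions and integration by parts -/

section AbsolutelyContinuous

/-- Transfers absolute continuity from a function whose increments dominate; this is how real-valued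
results reach functions with values in a Banach space. -/
lemma AbsolutelyContinuousOnInterval.of_dist_le {X Y : Type*} [PseudoMetricSpace X]
    [PseudoMetricSpace Y] {f : ℝ → X} {g : ℝ → Y} {a b : ℝ} (C : ℝ)
    (hg : AbsolutelyContinuousOnInterval g a b)
    (h : ∀ x ∈ uIcc a b, ∀ y ∈ uIcc a b, dist (f x) (f y) ≤ C * dist (g x) (g y)) :
    AbsolutelyContinuousOnInterval f a b := by
  have h1 := Tendsto.const_mul C hg
  rw [mul_zero] at h1
  refine squeeze_zero' (Eventually.of_forall fun E => Finset.sum_nonneg fun _ _ => dist_nonneg)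
    ?_ h1
  refine mem_inf_of_right (mem_principal.mpr fun E hE => ?_)
  change ∑ i ∈ Finset.range E.1, dist (f (E.2 i).1) (f (E.2 i).2) ≤
    C * ∑ i ∈ Finset.range E.1, dist (g (E.2 i).1) (g (E.2 i).2)
  rw [Finset.mul_sum]
  exact Finset.sum_le_sum fun i hi => h _ (hE.1 i hi).1 _ (hE.1 i hi).2

variable {F : Type*} [NormedAddCommGroup F] [NormedSpace ℝ F]

lemma absolutelyContinuousOnInterval_primitive {f : ℝ → F} {a b : ℝ}
    (hf : IntervalIntegrable f volume a b) :
    AbsolutelyContinuousOnInterval (fun x => ∫ s in a..x, f s) a b := by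
  have hi : ∀ x ∈ uIcc a b, IntervalIntegrable f volume a x := fun x hx =>
    hf.mono_set (uIcc_subset_uIcc_left hx)
  refine AbsolutelyContinuousOnInterval.of_dist_le 1
    (hf.norm.absolutelyContinuousOnInterval_intervalIntegral (left_mem_uIcc)) fun x hx y hy => ?_
  rw [dist_eq_norm, Real.dist_eq, one_mul, intervalIntegral.integral_interval_sub_left (hi x hx)
    (hi y hy), intervalIntegral.integral_interval_sub_left (hi x hx).norm (hi y hy).norm]
  exact intervalIntegral.norm_integral_le_abs_integral_norm

/-- The function f minus the primitive of g is absolutely continuous with derivative zero almost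
everywhere, hence constant. -/
lemma integral_eq_sub_of_absolutelyContinuous [CompleteSpace F] {f g : ℝ → F} {a b : ℝ}
    (hf : AbsolutelyContinuousOnInterval f a b)
    (hd : ∀ᵐ x, x ∈ uIcc a b → HasDerivAt f (g x) x) (hg : IntervalIntegrable g volume a b) :
    ∫ x in a..b, g x = f b - f a := by
  obtain ⟨C, hC⟩ := (hf.sub (absolutelyContinuousOnInterval_primitive
    hg)).const_of_ae_hasDerivAt_zero (by
      filter_upwards [hd, hg.ae_hasDerivAt_integral] with x h1 h2 hx
      simpa using (h1 hx).sub (h2 hx a left_mem_uIcc))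
  have h1 := hC a left_mem_uIcc
  have h2 := hC b right_mem_uIcc
  simp only [Pi.sub_apply, intervalIntegral.integral_same, sub_zero] at h1 h2
  rw [h1, ← h2]
  abel

lemma intervalIntegral_eq_Ioo (f : ℝ → F) :
    ∫ x in (0 : ℝ)..1, f x = ∫ x in Ioo (0 : ℝ) 1, f x := by
  rw [intervalIntegral.integral_of_le zero_le_one, integral_Ioc_eq_integral_Ioo]

lemma intervalIntegrable_iff_Ioo {F : Type*} [NormedAddCommGroup F] {f : ℝ → F} :
    IntervalIntegrable f volume 0 1 ↔ IntegrableOn f (Ioo 0 1) :=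
  intervalIntegrable_iff_integrableOn_Ioo_of_le zero_le_one

lemma continuousOn_primitive_Icc {w : ℝ → F} (hw : IntegrableOn w (Ioo 0 1)) :
    ContinuousOn (fun x => ∫ s in (0 : ℝ)..x, w s) (Icc 0 1) := by
  have := (absolutelyContinuousOnInterval_primitive
    (intervalIntegrable_iff_Ioo.mpr hw)).continuousOn
  rwa [uIcc_of_le zero_le_one] at this

lemma integral_deriv_smul_primitive [CompleteSpace F] {w : ℝ → F} (hw : IntegrableOn w (Ioo 0 1))
    {φ : ℝ → ℝ} (hφ : ContDiff ℝ ∞ φ) (h0 : φ 0 = 0) (h1 : φ 1 = 0) (a : F) :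
    ∫ ρ in Ioo (0 : ℝ) 1, deriv φ ρ • (a + ∫ s in (0 : ℝ)..ρ, w s) =
      - ∫ ρ in Ioo (0 : ℝ) 1, φ ρ • w ρ := by
  have hwi := intervalIntegrable_iff_Ioo.mpr hw
  have hWc : ContinuousOn (fun ρ => a + ∫ s in (0 : ℝ)..ρ, w s) (uIcc 0 1) := by
    rw [uIcc_of_le zero_le_one]
    exact (continuousOn_primitive_Icc hw).const_add a
  have hWac : AbsolutelyContinuousOnInterval (fun ρ => a + ∫ s in (0 : ℝ)..ρ, w s) 0 1 :=
    AbsolutelyContinuousOnInterval.of_dist_le 1 (absolutelyContinuousOnInterval_primitive hwi)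
      fun x _ y _ => by rw [dist_add_left, one_mul]
  have hφac : AbsolutelyContinuousOnInterval φ 0 1 :=
    (hφ.of_le (by simp)).contDiffOn.absolutelyContinuousOnInterval
  have hdc : Continuous (deriv φ) := hφ.continuous_deriv (by simp)
  have i1 : IntervalIntegrable (fun ρ => deriv φ ρ • (a + ∫ s in (0 : ℝ)..ρ, w s)) volume 0 1 :=
    (hdc.continuousOn.smul hWc).intervalIntegrable
  have i2 : IntervalIntegrable (fun ρ => φ ρ • w ρ) volume 0 1 :=
    hwi.continuousOn_smul hφ.continuous.continuousOn
  have h := integral_eq_sub_of_absolutelyContinuous (hφac.smul hWac)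
    (g := fun ρ => φ ρ • w ρ + deriv φ ρ • (a + ∫ s in (0 : ℝ)..ρ, w s)) (by
      filter_upwards [hwi.ae_hasDerivAt_integral] with x h2 hx
      exact ((hφ.differentiable (by simp)) x).hasDerivAt.smul
        ((h2 hx 0 left_mem_uIcc).const_add a)) (i2.add i1)
  rw [intervalIntegral.integral_add i2 i1] at h
  simp only [Pi.smul_apply', h0, h1, zero_smul, sub_zero] at h
  rw [← intervalIntegral_eq_Ioo, ← intervalIntegral_eq_Ioo, eq_neg_iff_add_eq_zero, add_comm]
  exact h

end AbsolutelyContinuous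

/-! ### Weak derivatives on (0,1): the du Bois-Reymond lemma and traces -/

section Sobolev

variable {U : Type*} [NormedAddCommGroup U] [InnerProductSpace ℂ U]

lemma testFunction_zero_of_notMem {φ : ℝ → ℝ} (h : tsupport φ ⊆ Ioo 0 1) {x : ℝ}
    (hx : x ∉ Ioo (0 : ℝ) 1) : φ x = 0 :=
  image_eq_zero_of_notMem_tsupport fun h' => hx (h h')

lemma isWeakDeriv_of_eq_primitive [CompleteSpace U] {z w : ℝ → U} (hw : IntegrableOn w (Ioo 0 1))
    (a : U) (hz : z =ᵐ[volume.restrict (Ioo 0 1)] fun ρ => a + ∫ s in (0 : ℝ)..ρ, w s) :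
    IsWeakDeriv z w := by
  intro φ h1 _ h3
  rw [← integral_deriv_smul_primitive hw h1 (testFunction_zero_of_notMem h3 (by simp))
    (testFunction_zero_of_notMem h3 (by simp)) a]
  exact integral_congr_ae (hz.mono fun ρ hρ => by simp only [hρ])

/-- A test function with integral zero is the derivative of a test function. -/
lemma exists_testFunction_deriv_eq {θ : ℝ → ℝ} (h1 : ContDiff ℝ ∞ θ) (h2 : HasCompactSupport θ)
    (h3 : tsupport θ ⊆ Ioo 0 1) (h0 : ∫ x in (0 : ℝ)..1, θ x = 0) :
    ∃ φ : ℝ → ℝ, ContDiff ℝ ∞ φ ∧ HasCompactSupport φ ∧ tsupport φ ⊆ Ioo 0 1 ∧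
      deriv φ = θ := by
  obtain ⟨a, b, ha, hb, hab⟩ : ∃ a b : ℝ, 0 < a ∧ b < 1 ∧ tsupport θ ⊆ Icc a b := by
    rcases (tsupport θ).eq_empty_or_nonempty with he | hne
    -- If θ vanishes identically, [1,0] serves as the empty interval.
    · exact ⟨1, 0, one_pos, one_pos, by simp [he]⟩
    · obtain ⟨a, ha⟩ := h2.isCompact.exists_isLeast hne
      obtain ⟨b, hb⟩ := h2.isCompact.exists_isGreatest hne
      exact ⟨a, b, (h3 ha.1).1, (h3 hb.1).2, fun x hx => ⟨ha.2 hx, hb.2 hx⟩⟩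
  have hθ : ∀ x, x ∉ Icc a b → θ x = 0 := fun x hx =>
    image_eq_zero_of_notMem_tsupport fun h' => hx (hab h')
  set φ : ℝ → ℝ := fun x => ∫ s in (0 : ℝ)..x, θ s
  have hd : deriv φ = θ := funext fun x => h1.continuous.deriv_integral θ 0 x
  have hsupp : tsupport φ ⊆ Icc a b := by
    refine closure_minimal (fun x hx => ?_) isClosed_Icc
    by_contra hx'
    refine hx ?_
    rw [mem_Icc, not_and_or, not_le, not_le] at hx'
    have hzero : ∀ y, (∀ s ∈ uIoc y x, θ s = 0) → ∫ s in y..x, θ s = 0 := fun y hy => by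
      rw [intervalIntegral.integral_congr_ae (g := fun _ => 0) (Eventually.of_forall hy)]
      simp
    rcases hx' with hx' | hx'
    · refine hzero 0 fun s hs => hθ s fun hs' => ?_
      have h4 : s ≤ max 0 x := hs.2
      have : max 0 x < a := max_lt ha hx'
      linarith [hs'.1]
    · change ∫ s in (0 : ℝ)..x, θ s = 0
      rw [← intervalIntegral.integral_add_adjacent_intervals
        (h1.continuous.intervalIntegrable 0 1) (h1.continuous.intervalIntegrable 1 x), h0, zero_add]
      refine hzero 1 fun s hs => hθ s fun hs' => ?_
      have h4 : min 1 x < s := hs.1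
      have : b < min 1 x := lt_min hb hx'
      linarith [hs'.2]
  refine ⟨φ, ?_, HasCompactSupport.of_support_subset_isCompact isCompact_Icc
    ((subset_tsupport φ).trans hsupp), hsupp.trans fun x hx => ⟨ha.trans_le hx.1,
    hx.2.trans_lt hb⟩, hd⟩
  rw [contDiff_infty_iff_deriv, hd]
  exact ⟨fun x => (h1.continuous.integral_hasStrictDerivAt 0 x).hasDerivAt.differentiableAt, h1⟩

lemma exists_testFunction_integral_one : ∃ χ : ℝ → ℝ, ContDiff ℝ ∞ χ ∧ HasCompactSupport χ ∧
    tsupport χ ⊆ Ioo 0 1 ∧ ∫ x in (0 : ℝ)..1, χ x = 1 := by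
  let f : ContDiffBump (1 / 2 : ℝ) := ⟨1 / 8, 1 / 4, by norm_num, by norm_num⟩
  have hs : tsupport (f.normed volume) ⊆ Ioo 0 1 := by
    rw [f.tsupport_normed_eq, Real.closedBall_eq_Icc]
    intro x hx
    have h1 := hx.1
    have h2 := hx.2
    change 1 / 2 - 1 / 4 ≤ x at h1
    change x ≤ 1 / 2 + 1 / 4 at h2
    constructor <;> linarith
  refine ⟨f.normed volume, f.contDiff_normed, f.hasCompactSupport_normed, hs, ?_⟩
  rw [intervalIntegral_eq_Ioo, setIntegral_eq_integral_of_forall_compl_eq_zero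
    fun x hx => testFunction_zero_of_notMem hs hx]
  exact f.integral_normed

/-- The du Bois-Reymond lemma. -/
lemma eq_const_of_integral_deriv_smul_eq_zero [CompleteSpace U] {f : ℝ → U}
    (hf : ContinuousOn f (Icc 0 1))
    (h : ∀ φ : ℝ → ℝ, ContDiff ℝ ∞ φ → HasCompactSupport φ → tsupport φ ⊆ Ioo 0 1 →
      ∫ ρ in Ioo (0 : ℝ) 1, deriv φ ρ • f ρ = 0) {x : ℝ} (hx : x ∈ Icc (0 : ℝ) 1) :
    f x = f 0 := by
  have hfi : IntegrableOn f (Ioo 0 1) :=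
    (hf.integrableOn_compact isCompact_Icc).mono_set Ioo_subset_Icc_self
  obtain ⟨χ, c1, c2, c3, c4⟩ := exists_testFunction_integral_one
  set k := ∫ ρ in Ioo (0 : ℝ) 1, χ ρ • f ρ
  have hae : ∀ᵐ ρ, ρ ∈ Ioo (0 : ℝ) 1 → f ρ - k = 0 := by
    refine isOpen_Ioo.ae_eq_zero_of_integral_contDiff_smul_eq_zero
      (hfi.sub (integrableOn_const (by simp))).locallyIntegrableOn fun ψ p1 p2 p3 => ?_
    -- Subtracting m χ makes the integral zero, so ψ - mχ = φ' for a test function φ. Then ∫ψ(f - k)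
    -- = ∫φ'f = 0, with k = ∫χf the candidate constant.
    set m := ∫ x in (0 : ℝ)..1, ψ x
    have hsub : tsupport (fun x => ψ x - m * χ x) ⊆ tsupport ψ ∪ tsupport χ := by
      refine closure_minimal (fun x hx => ?_)
        ((isClosed_tsupport ψ).union (isClosed_tsupport χ))
      by_contra hx'
      rw [mem_union, not_or] at hx'
      exact hx (by simp [image_eq_zero_of_notMem_tsupport hx'.1,
        image_eq_zero_of_notMem_tsupport hx'.2])
    obtain ⟨φ, q1, q2, q3, q4⟩ := exists_testFunction_deriv_eq (θ := fun x => ψ x - m * χ x)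
      (p1.sub (contDiff_const.mul c1))
      ((p2.isCompact.union c2.isCompact).of_isClosed_subset (isClosed_tsupport _) hsub)
      (hsub.trans (union_subset p3 c3)) (by
        have i1 : IntervalIntegrable (fun x => m * χ x) volume 0 1 :=
          (continuous_const.mul c1.continuous).intervalIntegrable _ _
        rw [intervalIntegral.integral_sub (p1.continuous.intervalIntegrable _ _) i1,
          intervalIntegral.integral_const_mul, c4, mul_one, sub_self])
    have h1 := h φ q1 q2 q3
    have i1 := integrable_test p1.continuous p2 hfi
    have i2 := integrable_test c1.continuous c2 hfi
    have i3 : Integrable (fun ρ => m • χ ρ • f ρ) (volume.restrict (Ioo 0 1)) := i2.smul m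
    have e1 : ∫ ρ in Ioo (0 : ℝ) 1, deriv φ ρ • f ρ =
        (∫ ρ in Ioo (0 : ℝ) 1, ψ ρ • f ρ) - m • k := by
      rw [q4, ← integral_smul, ← integral_sub i1 i3]
      exact integral_congr_ae (Eventually.of_forall fun ρ => by simp only [sub_smul, mul_smul])
    have e2 : ∫ ρ in Ioo (0 : ℝ) 1, ψ ρ • k = m • k := by
      rw [integral_smul_const, ← intervalIntegral_eq_Ioo]
    rw [← setIntegral_eq_integral_of_forall_compl_eq_zero (s := Ioo (0 : ℝ) 1)
      fun ρ hρ => by rw [testFunction_zero_of_notMem p3 hρ, zero_smul]]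
    simp only [smul_sub]
    rw [integral_sub i1 (integrable_test p1.continuous p2 (integrableOn_const (by simp))), e2,
      ← e1, h1]
  have hc : f =ᵐ[volume.restrict (Icc (0 : ℝ) 1)] fun _ => k := by
    rw [← restrict_Ioo_eq_restrict_Icc]
    exact (ae_restrict_iff' measurableSet_Ioo).mpr (hae.mono fun ρ hρ h => sub_eq_zero.mp (hρ h))
  have he := Measure.eqOn_Icc_of_ae_eq volume zero_ne_one hc hf continuousOn_const
  rw [he hx, he (left_mem_Icc.mpr zero_le_one)]

/-- The continuous representative minus the primitive of w has zero weak derivative, so it is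
constant by the du Bois-Reymond lemma. -/
lemma IsWeakDeriv.contRepr_eq [CompleteSpace U] {z w zc : ℝ → U} (hw : IntegrableOn w (Ioo 0 1))
    (h : IsWeakDeriv z w) (hc : IsContRepr z zc) {x : ℝ} (hx : x ∈ Icc (0 : ℝ) 1) :
    zc x = zc 0 + ∫ s in (0 : ℝ)..x, w s := by
  have hWc := continuousOn_primitive_Icc hw
  have hzi : IntegrableOn zc (Ioo 0 1) :=
    (hc.1.integrableOn_compact isCompact_Icc).mono_set Ioo_subset_Icc_self
  have hWi : IntegrableOn (fun x => ∫ s in (0 : ℝ)..x, w s) (Ioo 0 1) :=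
    (hWc.integrableOn_compact isCompact_Icc).mono_set Ioo_subset_Icc_self
  have h1 := eq_const_of_integral_deriv_smul_eq_zero
    (f := fun x => zc x - ∫ s in (0 : ℝ)..x, w s) (hc.1.sub hWc) (fun φ p1 p2 p3 => by
    have e1 := h φ p1 p2 p3
    have e2 := integral_deriv_smul_primitive hw p1 (testFunction_zero_of_notMem p3 (by simp))
      (testFunction_zero_of_notMem p3 (by simp)) 0
    have e3 : ∫ ρ in Ioo (0 : ℝ) 1, deriv φ ρ • zc ρ = ∫ ρ in Ioo (0 : ℝ) 1, deriv φ ρ • z ρ :=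
      integral_congr_ae (hc.2.mono fun ρ hρ => by simp only [hρ])
    have hdc := p1.continuous_deriv (by simp)
    simp only [zero_add] at e2
    simp only [smul_sub]
    rw [integral_sub (integrable_test hdc p2.deriv hzi) (integrable_test hdc p2.deriv hWi), e3, e1,
      e2, sub_self]) hx
  simp only [intervalIntegral.integral_same, sub_zero] at h1
  exact sub_eq_iff_eq_add.mp h1

/-- The integrand is half the derivative of ‖zc‖², which is absolutely continuous because zc is
absolutely continuous and bounded. This produces the boundary terms of the transport operator. -/
lemma integral_re_inner_primitive [CompleteSpace U] {w zc : ℝ → U} (hw : IntegrableOn w (Ioo 0 1))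
    (hz : ∀ x ∈ Icc (0 : ℝ) 1, zc x = zc 0 + ∫ s in (0 : ℝ)..x, w s) :
    ∫ ρ in Ioo (0 : ℝ) 1, (⟪zc ρ, w ρ⟫_ℂ).re = (‖zc 1‖ ^ 2 - ‖zc 0‖ ^ 2) / 2 := by
  have hwi := intervalIntegrable_iff_Ioo.mpr hw
  set W : ℝ → U := fun x => zc 0 + ∫ s in (0 : ℝ)..x, w s
  have hWac : AbsolutelyContinuousOnInterval W 0 1 :=
    AbsolutelyContinuousOnInterval.of_dist_le 1 (absolutelyContinuousOnInterval_primitive hwi)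
      fun x _ y _ => by rw [dist_add_left, one_mul]
  obtain ⟨C, hC⟩ := hWac.exists_bound
  have hN : AbsolutelyContinuousOnInterval (fun x => ‖W x‖ ^ 2) 0 1 :=
    AbsolutelyContinuousOnInterval.of_dist_le (2 * C) hWac fun x hx y hy => by
      have h1 := abs_norm_sub_norm_le (W x) (W y)
      rw [Real.dist_eq, sq_sub_sq, abs_mul, dist_eq_norm]
      refine mul_le_mul ?_ h1 (abs_nonneg _) (by linarith [hC x hx, norm_nonneg (W x)])
      rw [abs_of_nonneg (by positivity)]
      linarith [hC x hx, hC y hy]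
  have hi : IntervalIntegrable (fun ρ => 2 * (⟪W ρ, w ρ⟫_ℂ).re) volume 0 1 := by
    rw [intervalIntegrable_iff_Ioo]
    have hWm : AEStronglyMeasurable W (volume.restrict (Ioo 0 1)) :=
      ((hWac.continuousOn).mono (by
        rw [uIcc_of_le zero_le_one]; exact Ioo_subset_Icc_self)).aestronglyMeasurable
        measurableSet_Ioo
    refine Integrable.mono' (hw.norm.const_mul (2 * C))
      ((Complex.continuous_re.comp_aestronglyMeasurable
        (hWm.inner hw.aestronglyMeasurable)).const_mul 2)
      ((ae_restrict_iff' measurableSet_Ioo).mpr (Eventually.of_forall fun ρ hρ => ?_))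
    have h1 : ‖W ρ‖ ≤ C := hC ρ (by
      rw [uIcc_of_le zero_le_one]; exact Ioo_subset_Icc_self hρ)
    have h2 : |(⟪W ρ, w ρ⟫_ℂ).re| ≤ ‖W ρ‖ * ‖w ρ‖ :=
      (Complex.abs_re_le_norm _).trans (norm_inner_le_norm _ _)
    rw [Real.norm_eq_abs, abs_mul, abs_two, mul_assoc]
    exact mul_le_mul_of_nonneg_left
      (h2.trans (mul_le_mul_of_nonneg_right h1 (norm_nonneg _))) two_pos.le
  have h := integral_eq_sub_of_absolutelyContinuous hN
    (g := fun ρ => 2 * (⟪W ρ, w ρ⟫_ℂ).re) (by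
      filter_upwards [hwi.ae_hasDerivAt_integral] with x h2 hx
      have h3 : HasDerivAt W (w x) x := (h2 hx 0 left_mem_uIcc).const_add (zc 0)
      rw [← hasDerivWithinAt_univ] at h3 ⊢
      exact hasDerivWithinAt_norm_sq h3) hi
  have h1 : W 1 = zc 1 := (hz 1 (by simp)).symm
  have h0 : W 0 = zc 0 := by simp [W]
  rw [intervalIntegral.integral_const_mul, h1, h0] at h
  rw [← intervalIntegral_eq_Ioo, ← h, mul_div_cancel_left₀ _ two_ne_zero]
  refine intervalIntegral.integral_congr fun x hx => ?_
  rw [uIcc_of_le zero_le_one] at hx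
  simp only [W, ← hz x hx]

end Sobolev

/-! ### The energy space and maximal dissipativity of A_g -/

section EnergySpace

variable {H : Type*} [NormedAddCommGroup H] [InnerProductSpace ℂ H] [CompleteSpace H]
variable {U : Type*} [NormedAddCommGroup U] [InnerProductSpace ℂ U] [CompleteSpace U]

namespace PosInvOp

variable (A : PosInvOp H)

lemma invSqrt_nonneg : 0 ≤ A.invSqrt := CFC.sqrt_nonneg A.inv

lemma invSqrt_symm (x y : H) : ⟪A.invSqrt x, y⟫_ℂ = ⟪x, A.invSqrt y⟫_ℂ :=
  ((ContinuousLinearMap.nonneg_iff_isPositive _).mp A.invSqrt_nonneg).1 x y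

lemma incl_eq (x : A.Half) : A.incl x = A.invSqrt (A.sqrtHalf x) := (A.invSqrt_sqrt x).symm

/-- The inclusion `H_{1/2} → H` as a bounded operator. -/
def inclL : A.Half →L[ℂ] H := A.invSqrt ∘L (A.sqrtIso : A.Half →L[ℂ] H)

lemma inclL_apply (x : A.Half) : A.inclL x = A.incl x := (A.incl_eq x).symm

lemma inv_op (x : A.op.domain) : A.inv (A.op x) = x :=
  congrArg Subtype.val (A.equiv.symm_apply_apply x)

lemma inv_mem (x : H) : A.inv x ∈ A.op.domain := (A.equiv.symm x).2

lemma op_inv (x : H) : A.op ⟨A.inv x, A.inv_mem x⟩ = x := A.equiv.apply_symm_apply x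

lemma sqrtHalf_eq {x : A.Half} (h : A.incl x ∈ A.op.domain) :
    A.sqrtHalf x = A.invSqrt (A.op ⟨A.incl x, h⟩) := by
  apply A.invSqrt_injective
  rw [invSqrt_invSqrt, inv_op, ← incl_eq]

/-- The identity ⟨A^{1/2}x, A^{1/2}y⟩ = ⟨Ax, y⟩, in the form that cancels the wave terms in the
energy balance. -/
lemma half_inner {x y : A.Half} (h : A.incl x ∈ A.op.domain) :
    ⟪x, y⟫_ℂ = ⟪A.op ⟨A.incl x, h⟩, A.incl y⟫_ℂ := by
  change ⟪A.sqrtHalf x, A.sqrtHalf y⟫_ℂ = _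
  rw [sqrtHalf_eq A h, invSqrt_symm, incl_eq A y]

end PosInvOp

lemma L2.inner_eq {ξ : ℝ} (hξ : 0 < ξ) (z w : L2 U ξ) :
    ⟪z, w⟫_ℂ = ξ * ∫ ρ in Ioo (0 : ℝ) 1, ⟪z ρ, w ρ⟫_ℂ := by
  rw [L2.inner_def, integral_smul_measure, ENNReal.toReal_ofReal hξ.le, Complex.real_smul]

lemma IsWeakDeriv.re_inner_eq {ξ : ℝ} (hξ : 0 < ξ) {z w : L2 U ξ} {zc : ℝ → U}
    (h : IsWeakDeriv z w) (hc : IsContRepr z zc) :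
    (⟪z, w⟫_ℂ).re = ξ * ((‖zc 1‖ ^ 2 - ‖zc 0‖ ^ 2) / 2) := by
  have hwi := L2.integrableOn hξ w
  rw [L2.inner_eq hξ, Complex.re_ofReal_mul, ← integral_re_inner_primitive hwi
    fun x hx => h.contRepr_eq hwi hc hx]
  congr 1
  have hint : Integrable (fun ρ => ⟪z ρ, w ρ⟫_ℂ) (volume.restrict (Ioo 0 1)) := by
    have h1 := (L2.integrable_inner (𝕜 := ℂ) z w)
    rwa [integrable_smul_measure (by simpa using hξ) (by simp)] at h1
  have h2 := integral_re (𝕜 := ℂ) hint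
  refine Eq.trans h2.symm (integral_congr_ae (hc.2.mono fun ρ hρ => ?_))
  simp only [hρ]
  rfl

namespace Hg

variable {A : PosInvOp H} {ξ : ℝ}

lemma inner_eq (X Y : Hg A U ξ) : ⟪X, Y⟫_ℂ = ⟪X.u, Y.u⟫_ℂ + (⟪X.v, Y.v⟫_ℂ + ⟪X.z, Y.z⟫_ℂ) := by
  rw [WithLp.prod_inner_apply, WithLp.prod_inner_apply]
  rfl

lemma norm_v_le (X : Hg A U ξ) : ‖X.v‖ ≤ ‖X‖ :=
  (WithLp.norm_fst_le _ X.snd).trans (WithLp.norm_snd_le _ X)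

/-- The component `u` as a bounded operator. -/
def uL : Hg A U ξ →L[ℂ] A.Half := WithLp.fstL 2 ℂ _ _

/-- The component `v` as a bounded operator. -/
def vL : Hg A U ξ →L[ℂ] H := WithLp.fstL 2 ℂ _ _ ∘L WithLp.sndL 2 ℂ _ _

/-- The component `z` as a bounded operator. -/
def zL : Hg A U ξ →L[ℂ] L2 U ξ := WithLp.sndL 2 ℂ _ _ ∘L WithLp.sndL 2 ℂ _ _

lemma uL_apply (X : Hg A U ξ) : uL X = X.u := rfl

end Hg

variable {A : PosInvOp H} {B : U →L[ℂ] H} {μ T₀ ξ : ℝ}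

/-- The constant by which `A_g` has to be shifted to become dissipative. -/
abbrev growth (B : U →L[ℂ] H) (μ T₀ ξ : ℝ) : ℝ := (|μ| / 2 + ξ / (2 * T₀)) * ‖B.adjoint‖ ^ 2

lemma growth_nonneg (hT₀ : 0 < T₀) (hξ : 0 < ξ) : 0 ≤ growth B μ T₀ ξ := by
  unfold growth
  positivity

/-- After cancellation of ⟨Au, v⟩ the energy balance is -μ Re⟨B^*v, z(1)⟩ - (ξ/2T₀)(‖z(1)‖² -
‖B^*v‖²); the condition z(0) = B^*v has replaced the trace at 0. -/
lemma GenRel.re_inner_le (hT₀ : 0 < T₀) (hξ : 0 < ξ) (hμ : |μ| * T₀ ≤ ξ) {x y : Hg A U ξ}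
    (h : GenRel A B μ T₀ ξ x y) : (⟪x, y⟫_ℂ).re ≤ growth B μ T₀ ξ * ‖x‖ ^ 2 := by
  obtain ⟨hu, w, zc, hw, hc, hb, e, f, g⟩ := h
  have h1 : ⟪x.u, y.u⟫_ℂ = ⟪A.op ⟨A.incl x.u, hu⟩, x.v⟫_ℂ := by rw [A.half_inner hu, e]
  have h2 : (⟪x.v, y.v⟫_ℂ).re = - (⟪A.op ⟨A.incl x.u, hu⟩, x.v⟫_ℂ).re -
      μ * (⟪B.adjoint x.v, zc 1⟫_ℂ).re := by
    rw [f, inner_sub_right, inner_neg_right, inner_smul_right_eq_smul, Complex.sub_re,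
      Complex.neg_re, Complex.smul_re, smul_eq_mul, ContinuousLinearMap.adjoint_inner_left]
    congr 2
    exact inner_re_symm (𝕜 := ℂ) _ _
  have h3 : (⟪x.z, y.z⟫_ℂ).re = - (T₀⁻¹ * (ξ * ((‖zc 1‖ ^ 2 - ‖zc 0‖ ^ 2) / 2))) := by
    rw [g, inner_neg_right, inner_smul_right_eq_smul, Complex.neg_re, Complex.smul_re,
      hw.re_inner_eq hξ hc, smul_eq_mul]
  rw [Hg.inner_eq, h1, Complex.add_re, Complex.add_re, h2, h3, hb]
  have h4 : |(⟪B.adjoint x.v, zc 1⟫_ℂ).re| ≤ ‖B.adjoint x.v‖ * ‖zc 1‖ :=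
    (Complex.abs_re_le_norm _).trans (norm_inner_le_norm _ _)
  have h5 : ‖B.adjoint x.v‖ ≤ ‖B.adjoint‖ * ‖x‖ :=
    (B.adjoint.le_opNorm _).trans (mul_le_mul_of_nonneg_left x.norm_v_le (norm_nonneg _))
  have h6 : ‖B.adjoint x.v‖ ^ 2 ≤ ‖B.adjoint‖ ^ 2 * ‖x‖ ^ 2 := by
    rw [← mul_pow]
    exact pow_le_pow_left₀ (norm_nonneg _) h5 2
  set a := ‖B.adjoint x.v‖
  set b := ‖zc 1‖
  set r := (⟪B.adjoint x.v, zc 1⟫_ℂ).re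
  have h7 : -(μ * r) ≤ |μ| * (a * b) := by
    refine (neg_le_abs _).trans ?_
    rw [abs_mul]
    exact mul_le_mul_of_nonneg_left h4 (abs_nonneg _)
  have h8 : |μ| ≤ ξ / T₀ := (le_div_iff₀ hT₀).mpr hμ
  have h9 : ξ / (2 * T₀) = ξ / T₀ / 2 := by field_simp
  have h10 : T₀⁻¹ * (ξ * ((b ^ 2 - a ^ 2) / 2)) = ξ / T₀ / 2 * (b ^ 2 - a ^ 2) := by field_simp
  unfold growth
  rw [h9, h10]
  set q := ξ / T₀
  have h11 : 0 ≤ |μ| := abs_nonneg μ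
  have h12 : (|μ| / 2 + q / 2) * a ^ 2 ≤ (|μ| / 2 + q / 2) * (‖B.adjoint‖ ^ 2 * ‖x‖ ^ 2) :=
    mul_le_mul_of_nonneg_left h6 (by linarith)
  -- Young: |μ|ab ≤ |μ|(a² + b²)/2, and the coefficient (|μ| - q)/2 of b² is nonpositive.
  nlinarith [mul_nonneg h11 (sq_nonneg (a - b)), mul_nonneg (sub_nonneg.mpr h8) (sq_nonneg b)]

/-- The spectrum of a nonnegative operator avoids -1, so 1 + P is invertible. -/
lemma exists_add_eq_of_nonneg {P : H →L[ℂ] H} (hP : 0 ≤ P) (r : H) : ∃ y, y + P y = r := by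
  have h1 : (-1 : ℝ) ∉ spectrum ℝ P := fun h => by
    have := spectrum_nonneg_of_nonneg hP h
    linarith
  rw [spectrum.notMem_iff] at h1
  obtain ⟨Q, hQ⟩ := h1.exists_right_inv
  refine ⟨-(Q r), ?_⟩
  have h2 := congrArg (fun T : H →L[ℂ] H => T r) hQ
  simp only [map_neg, map_one] at h2
  have h3 : -(Q r) - P (Q r) = r := h2
  rw [map_neg, ← sub_eq_add_neg, h3]

/-- Solvability of the stationary problem `A u + M u = r`. -/
lemma PosInvOp.exists_op_add_eq (A : PosInvOp H) {M : H →L[ℂ] H} (hM : M.IsPositive) (r : H) :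
    ∃ (u : A.Half) (hu : A.incl u ∈ A.op.domain), A.op ⟨A.incl u, hu⟩ + M (A.incl u) = r := by
  have hP : 0 ≤ A.invSqrt ∘L M ∘L A.invSqrt := by
    rw [ContinuousLinearMap.nonneg_iff_isPositive]
    refine ⟨fun x y => ?_, fun x => ?_⟩
    · change ⟪A.invSqrt (M (A.invSqrt x)), y⟫_ℂ = ⟪x, A.invSqrt (M (A.invSqrt y))⟫_ℂ
      rw [A.invSqrt_symm, ← A.invSqrt_symm x]
      exact hM.1 _ _
    · change 0 ≤ (⟪A.invSqrt (M (A.invSqrt x)), x⟫_ℂ).re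
      rw [A.invSqrt_symm]
      exact hM.2 _
  -- Put u = A^{-1/2}y and apply A^{-1/2} to the equation. The solution satisfies u = A^{-1}(r -
  -- Mu), which places it in D(A).
  obtain ⟨y, hy⟩ := exists_add_eq_of_nonneg hP (A.invSqrt r)
  have hu : A.incl (A.sqrtIso.symm y) = A.invSqrt y := by
    rw [A.incl_eq]
    congr 1
    exact A.sqrtIso.apply_symm_apply y
  have h1 : A.invSqrt y = A.inv (r - M (A.invSqrt y)) := by
    rw [← A.invSqrt_invSqrt, map_sub]
    exact congrArg A.invSqrt (eq_sub_iff_add_eq.mpr hy)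
  have hmem : A.incl (A.sqrtIso.symm y) ∈ A.op.domain := by
    rw [hu, h1]; exact A.inv_mem _
  refine ⟨A.sqrtIso.symm y, hmem, ?_⟩
  have h2 : A.op ⟨A.incl (A.sqrtIso.symm y), hmem⟩ = r - M (A.invSqrt y) := by
    rw [← A.op_inv (r - M (A.invSqrt y))]
    exact congrArg A.op (Subtype.ext (hu.trans h1))
  rw [h2, hu, sub_add_cancel]

lemma memLp_of_continuousOn {f : ℝ → U} (hf : ContinuousOn f (Icc 0 1)) :
    MemLp f 2 (ENNReal.ofReal ξ • (volume : Measure ℝ).restrict (Ioo 0 1)) := by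
  obtain ⟨C, hC⟩ := isCompact_Icc.exists_bound_of_continuousOn hf
  refine MemLp.smul_measure ?_ ENNReal.ofReal_ne_top
  exact MemLp.of_bound ((hf.mono Ioo_subset_Icc_self).aestronglyMeasurable measurableSet_Ioo) C
    ((ae_restrict_iff' measurableSet_Ioo).mpr (Eventually.of_forall fun ρ hρ =>
      hC ρ (Ioo_subset_Icc_self hρ)))

lemma L2.ae_eq_toLp (hξ : 0 < ξ) {f : ℝ → U} (hf : MemLp f 2 (ENNReal.ofReal ξ •
    (volume : Measure ℝ).restrict (Ioo 0 1))) :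
    (hf.toLp f : L2 U ξ) =ᵐ[volume.restrict (Ioo 0 1)] f :=
  (absCont hξ).ae_le hf.coeFn_toLp

/-- The resolvent equation `z' = T₀ (h - l z)`, `z(0) = b` of the transport operator. -/
lemma L2.exists_transport_resolvent (hξ : 0 < ξ) (T₀ l : ℝ) (h : L2 U ξ) : ∃ p : U, ∀ b : U,
    ∃ (z w : L2 U ξ) (zc : ℝ → U), IsWeakDeriv z w ∧ IsContRepr z zc ∧ zc 0 = b ∧
      zc 1 = Real.exp (-(l * T₀)) • (b + p) ∧ w = T₀ • (h - l • z) := by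
  have hh := L2.integrableOn hξ h
  have hwi : IntegrableOn (fun s => (T₀ * Real.exp (l * T₀ * s)) • h s) (Ioo 0 1) :=
    intervalIntegrable_iff_Ioo.mp ((intervalIntegrable_iff_Ioo.mpr hh).continuousOn_smul
      (by fun_prop))
  -- Variation of constants: z(ρ) = e^{-lT₀ρ}(b + ∫₀^ρ T₀e^{lT₀s}h ds). The number p does not depend
  -- on b, so z(1) is affine in b and can be substituted into the wave equation.
  refine ⟨∫ s in (0 : ℝ)..1, (T₀ * Real.exp (l * T₀ * s)) • h s, fun b => ?_⟩
  set zc : ℝ → U := fun ρ => Real.exp (-(l * T₀ * ρ)) •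
    (b + ∫ s in (0 : ℝ)..ρ, (T₀ * Real.exp (l * T₀ * s)) • h s) with hzc
  have hcont : ContinuousOn zc (Icc 0 1) :=
    (by fun_prop : Continuous fun ρ : ℝ => Real.exp (-(l * T₀ * ρ))).continuousOn.smul
      ((continuousOn_primitive_Icc hwi).const_add b)
  have hmem := memLp_of_continuousOn (ξ := ξ) hcont
  have hae := L2.ae_eq_toLp hξ hmem
  refine ⟨hmem.toLp zc, T₀ • (h - l • hmem.toLp zc), zc, fun φ h1 h2 h3 => ?_, ⟨hcont, hae⟩,
    by simp [hzc], by simp [hzc], rfl⟩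
  have hE : ContDiff ℝ ∞ fun ρ : ℝ => Real.exp (-(l * T₀ * ρ)) := by fun_prop
  have hz : ∀ {x : ℝ}, x ∉ Ioo (0 : ℝ) 1 → φ x = 0 := testFunction_zero_of_notMem h3
  -- Testing the primitive with φ(ρ)e^{-lT₀ρ} moves the exponential factor of z onto the test
  -- function.
  have key := integral_deriv_smul_primitive hwi (h1.mul hE) (by simp [hz]) (by simp [hz]) b
  have hd : ∀ ρ, deriv (fun ρ => φ ρ * Real.exp (-(l * T₀ * ρ))) ρ =
      deriv φ ρ * Real.exp (-(l * T₀ * ρ)) -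
        l * T₀ * (φ ρ * Real.exp (-(l * T₀ * ρ))) := fun ρ => by
    have d1 := ((h1.differentiable (by simp)) ρ).hasDerivAt
    have d2 := (((hasDerivAt_id ρ).const_mul (l * T₀)).neg).exp
    refine (d1.fun_mul d2).deriv.trans ?_
    simp only [Pi.neg_apply, id_eq]
    ring
  have hw : (T₀ • (h - l • hmem.toLp zc) : L2 U ξ) =ᵐ[volume.restrict (Ioo 0 1)]
      fun ρ => T₀ • (h ρ - l • zc ρ) := by
    filter_upwards [(absCont hξ).ae_le (Lp.coeFn_smul T₀ (h - l • hmem.toLp zc)),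
      (absCont hξ).ae_le (Lp.coeFn_sub h (l • hmem.toLp zc)),
      (absCont hξ).ae_le (Lp.coeFn_smul l (hmem.toLp zc)), hae] with ρ a1 a2 a3 a4
    rw [a1, Pi.smul_apply, a2, Pi.sub_apply, a3, Pi.smul_apply, a4]
  have hzi : IntegrableOn zc (Ioo 0 1) :=
    (hcont.integrableOn_compact isCompact_Icc).mono_set Ioo_subset_Icc_self
  have i1 := integrable_test (h1.continuous_deriv (by simp)) h2.deriv hzi
  have i2 := integrable_test h1.continuous h2 hzi
  have i3 := integrable_test h1.continuous h2 hh
  have i2' : Integrable (fun ρ => (l * T₀) • φ ρ • zc ρ) (volume.restrict (Ioo 0 1)) :=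
    i2.smul (l * T₀)
  have i3' : Integrable (fun ρ => T₀ • φ ρ • h ρ) (volume.restrict (Ioo 0 1)) := i3.smul T₀
  have e1 : ∫ ρ in Ioo (0 : ℝ) 1, deriv φ ρ • (hmem.toLp zc : L2 U ξ) ρ =
      ∫ ρ in Ioo (0 : ℝ) 1, deriv φ ρ • zc ρ :=
    integral_congr_ae (hae.mono fun ρ hρ => by simp only [hρ])
  have e2 : ∫ ρ in Ioo (0 : ℝ) 1, φ ρ • (T₀ • (h - l • hmem.toLp zc) : L2 U ξ) ρ =
      T₀ • (∫ ρ in Ioo (0 : ℝ) 1, φ ρ • h ρ) - (l * T₀) • ∫ ρ in Ioo (0 : ℝ) 1, φ ρ • zc ρ := by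
    rw [← integral_smul, ← integral_smul, ← integral_sub i3' i2']
    refine integral_congr_ae (hw.mono fun ρ hρ => ?_)
    beta_reduce
    rw [hρ]
    simp only [smul_sub, smul_smul]
    congr 2 <;> ring
  have e3 : ∫ ρ in Ioo (0 : ℝ) 1, deriv (fun ρ => φ ρ * Real.exp (-(l * T₀ * ρ))) ρ •
      (b + ∫ s in (0 : ℝ)..ρ, (T₀ * Real.exp (l * T₀ * s)) • h s) =
      (∫ ρ in Ioo (0 : ℝ) 1, deriv φ ρ • zc ρ) -
        (l * T₀) • ∫ ρ in Ioo (0 : ℝ) 1, φ ρ • zc ρ := by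
    rw [← integral_smul, ← integral_sub i1 i2']
    refine integral_congr_ae (Eventually.of_forall fun ρ => ?_)
    beta_reduce
    rw [hd]
    simp only [hzc]
    module
  have e4 : ∫ ρ in Ioo (0 : ℝ) 1, (φ ρ * Real.exp (-(l * T₀ * ρ))) •
      (T₀ * Real.exp (l * T₀ * ρ)) • h ρ = T₀ • ∫ ρ in Ioo (0 : ℝ) 1, φ ρ • h ρ := by
    rw [← integral_smul]
    refine integral_congr_ae (Eventually.of_forall fun ρ => ?_)
    have h4 : Real.exp (-(l * T₀ * ρ)) * Real.exp (l * T₀ * ρ) = 1 := by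
      rw [← Real.exp_add, neg_add_cancel, Real.exp_zero]
    simp only [smul_smul]
    congr 1
    linear_combination φ ρ * T₀ * h4
  rw [e3, e4] at key
  rw [e1, e2, neg_sub, sub_eq_iff_eq_add.mp key]
  abel

/-- The operator `l² + κ B B^*` is positive if `|κ| ‖B^*‖² ≤ l²`. -/
lemma isPositive_stationary {l κ : ℝ} (hκ : |κ| * ‖B.adjoint‖ ^ 2 ≤ l ^ 2) :
    ((l ^ 2 : ℝ) • (1 : H →L[ℂ] H) + κ • (B ∘L B.adjoint)).IsPositive := by
  refine ⟨fun x y => ?_, fun x => ?_⟩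
  · change ⟪(l ^ 2 : ℝ) • x + κ • B (B.adjoint x), y⟫_ℂ =
      ⟪x, (l ^ 2 : ℝ) • y + κ • B (B.adjoint y)⟫_ℂ
    rw [inner_add_left, inner_add_right, inner_smul_left_eq_smul, inner_smul_left_eq_smul,
      inner_smul_right_eq_smul, inner_smul_right_eq_smul,
      ← ContinuousLinearMap.adjoint_inner_right, ContinuousLinearMap.adjoint_inner_left]
  · change 0 ≤ (⟪(l ^ 2 : ℝ) • x + κ • B (B.adjoint x), x⟫_ℂ).re
    have h1 : (⟪x, x⟫_ℂ).re = ‖x‖ ^ 2 := inner_self_eq_norm_sq (𝕜 := ℂ) x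
    have h2 : (⟪B.adjoint x, B.adjoint x⟫_ℂ).re = ‖B.adjoint x‖ ^ 2 :=
      inner_self_eq_norm_sq (𝕜 := ℂ) _
    rw [inner_add_left, inner_smul_left_eq_smul, inner_smul_left_eq_smul,
      ← ContinuousLinearMap.adjoint_inner_right, Complex.add_re, Complex.smul_re, Complex.smul_re,
      h1, h2, smul_eq_mul, smul_eq_mul]
    have h3 : ‖B.adjoint x‖ ^ 2 ≤ ‖B.adjoint‖ ^ 2 * ‖x‖ ^ 2 := by
      rw [← mul_pow]
      exact pow_le_pow_left₀ (norm_nonneg _) (B.adjoint.le_opNorm x) 2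
    have h4 := neg_abs_le κ
    have h5 := mul_le_mul_of_nonneg_left h3 (abs_nonneg κ)
    have h6 := mul_le_mul_of_nonneg_right h4 (sq_nonneg ‖B.adjoint x‖)
    have h7 := mul_le_mul_of_nonneg_right hκ (sq_nonneg ‖x‖)
    linarith

/-- The first row gives v = lu - y.u and the transport row gives z(1) = e(B^*v + p) with e =
e^{-lT₀}. The second row is then Au + (l² + lμe BB^*)u = y.v + l y.u + μe B(B^* y.u - p), a
stationary problem with positive perturbation. -/
lemma GenRel.exists_resolvent (hT₀ : 0 < T₀) (hξ : 0 < ξ) (hμ : |μ| * T₀ ≤ ξ) {l : ℝ}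
    (hl : growth B μ T₀ ξ < l) (y : Hg A U ξ) :
    ∃ x x' : Hg A U ξ, GenRel A B μ T₀ ξ x x' ∧ (l : ℂ) • x - x' = y := by
  have hl0 : 0 < l := (growth_nonneg hT₀ hξ).trans_lt hl
  obtain ⟨p, hp⟩ := L2.exists_transport_resolvent hξ T₀ l y.z
  set e := Real.exp (-(l * T₀))
  have he0 : 0 < e := Real.exp_pos _
  have he1 : e ≤ 1 := Real.exp_le_one_iff.mpr (by nlinarith)
  have hκ : |l * (μ * e)| * ‖B.adjoint‖ ^ 2 ≤ l ^ 2 := by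
    -- Since |μ|T₀ ≤ ξ, the growth constant is at least |μ|‖B^*‖².
    have h1 : |μ| * ‖B.adjoint‖ ^ 2 ≤ l := by
      refine le_trans ?_ hl.le
      have h2 : |μ| / 2 ≤ ξ / (2 * T₀) := by
        rw [div_le_div_iff₀ two_pos (by positivity)]
        linarith
      exact mul_le_mul_of_nonneg_right (by linarith) (sq_nonneg _)
    rw [abs_mul, abs_mul, abs_of_pos hl0, abs_of_pos he0]
    calc l * (|μ| * e) * ‖B.adjoint‖ ^ 2 = l * e * (|μ| * ‖B.adjoint‖ ^ 2) := by ring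
      _ ≤ l * 1 * l := by gcongr
      _ = l ^ 2 := by ring
  obtain ⟨u, hu, hr⟩ := A.exists_op_add_eq (isPositive_stationary hκ)
    (y.v + l • A.incl y.u + (μ * e) • B (B.adjoint (A.incl y.u) - p))
  set v := l • A.incl u - A.incl y.u
  obtain ⟨z, w, zc, hw, hc, hb, hz1, hweq⟩ := hp (B.adjoint v)
  refine ⟨Hg.mk u v z, (l : ℂ) • Hg.mk u v z - y, ⟨hu, w, zc, hw, hc, hb, ?_, ?_, ?_⟩, ?_⟩
  · change A.incl ((l : ℂ) • u - y.u) = v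
    rw [map_sub, map_smul]
    rfl
  · change (l : ℂ) • v - y.v = - A.op ⟨A.incl u, hu⟩ - μ • B (zc 1)
    have hr' : A.op ⟨A.incl u, hu⟩ +
        (l ^ 2 • A.incl u + (l * (μ * e)) • B (B.adjoint (A.incl u))) =
      y.v + l • A.incl y.u + (μ * e) • B (B.adjoint (A.incl y.u) - p) := hr
    have hBe : B (zc 1) =
        e • (l • B (B.adjoint (A.incl u)) - B (B.adjoint (A.incl y.u)) + B p) := by
      rw [hz1, ContinuousLinearMap.map_smul_of_tower, map_add, map_sub, map_sub,
        ContinuousLinearMap.map_smul_of_tower, ContinuousLinearMap.map_smul_of_tower]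
    rw [Complex.coe_smul, hBe, eq_sub_of_add_eq hr', map_sub]
    simp only [v]
    module
  · change (l : ℂ) • z - y.z = - (T₀⁻¹ • w)
    rw [hweq, smul_smul, inv_mul_cancel₀ hT₀.ne', one_smul, neg_sub]
    rfl
  · exact sub_sub_cancel _ _

lemma IsMaximalDissipativeShift.of_graph {E : Type*} [NormedAddCommGroup E]
    [InnerProductSpace ℂ E] {G : E →ₗ.[ℂ] E} {c : ℝ}
    (h1 : ∀ x y, (x, y) ∈ G.graph → (⟪x, y⟫_ℂ).re ≤ c * ‖x‖ ^ 2)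
    (h2 : ∀ l : ℝ, c < l → ∀ y, ∃ x x', (x, x') ∈ G.graph ∧ (l : ℂ) • x - x' = y) :
    IsMaximalDissipativeShift G c := by
  refine ⟨fun x => ?_, fun l hl y => ?_⟩
  · have h3 := h1 _ _ (G.mem_graph x)
    have h4 : (⟪(x : E), (x : E)⟫_ℂ).re = ‖(x : E)‖ ^ 2 := inner_self_eq_norm_sq (𝕜 := ℂ) (x : E)
    rw [inner_sub_right, inner_smul_right_eq_smul, Complex.sub_re, Complex.smul_re, h4,
      smul_eq_mul]
    linarith
  · obtain ⟨x, x', h, hxy⟩ := h2 (l + c) (by linarith) y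
    obtain ⟨hx, rfl⟩ := mem_graph_iff_exists.mp h
    refine ⟨⟨x, hx⟩, ?_⟩
    rw [← hxy, Complex.coe_smul, add_smul]
    abel

lemma Ag_isMaximalDissipativeShift (hT₀ : 0 < T₀) (hξ : 0 < ξ) (hμ : |μ| * T₀ ≤ ξ) :
    IsMaximalDissipativeShift (Ag A B μ T₀ hξ) (growth B μ T₀ ξ) :=
  IsMaximalDissipativeShift.of_graph
    (fun _ _ h => GenRel.re_inner_le hT₀ hξ hμ ((mem_Ag_graph hξ).mp h))
    fun _ hl y => by
      obtain ⟨x, x', h, hxy⟩ := GenRel.exists_resolvent hT₀ hξ hμ hl y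
      exact ⟨x, x', (mem_Ag_graph hξ).mpr h, hxy⟩

end EnergySpace

/-! ### The delay system: uniqueness, and identification of the history variable -/

section DelaySystem

variable {H : Type*} [NormedAddCommGroup H] [InnerProductSpace ℂ H] [CompleteSpace H]
variable {U : Type*} [NormedAddCommGroup U] [InnerProductSpace ℂ U] [CompleteSpace U]
variable {A : PosInvOp H} {B : U →L[ℂ] H} {μ T₀ ξ : ℝ}

lemma hasDerivWithinAt_clm {E F : Type*} [NormedAddCommGroup E] [NormedSpace ℂ E]
    [NormedAddCommGroup F] [NormedSpace ℂ F] (L : E →L[ℂ] F) {f : ℝ → E} {f' : E}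
    {s : Set ℝ} {t : ℝ} (h : HasDerivWithinAt f f' s t) :
    HasDerivWithinAt (fun t => L (f t)) (L f') s t :=
  (L.restrictScalars ℝ).hasFDerivAt.comp_hasDerivWithinAt t h

lemma integral_clm {E F : Type*} [NormedAddCommGroup E] [NormedSpace ℂ E] [CompleteSpace E]
    [NormedAddCommGroup F] [NormedSpace ℂ F] [CompleteSpace F] (L : E →L[ℂ] F) {f : ℝ → E}
    (hf : ContinuousOn f (Ici 0)) {t : ℝ} (ht : 0 ≤ t) :
    L (∫ s in (0 : ℝ)..t, f s) = ∫ s in (0 : ℝ)..t, L (f s) :=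
  (L.intervalIntegral_comp_comm (ContinuousOn.intervalIntegrable_Ici hf le_rfl ht)).symm

lemma integral_sub_Ici {E : Type*} [NormedAddCommGroup E] [NormedSpace ℂ E] {f g : ℝ → E}
    (hf : ContinuousOn f (Ici 0)) (hg : ContinuousOn g (Ici 0)) {t : ℝ} (ht : 0 ≤ t) :
    ∫ s in (0 : ℝ)..t, (f s - g s) = (∫ s in (0 : ℝ)..t, f s) - ∫ s in (0 : ℝ)..t, g s :=
  intervalIntegral.integral_sub (ContinuousOn.intervalIntegrable_Ici hf le_rfl ht)
    (ContinuousOn.intervalIntegrable_Ici hg le_rfl ht)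

/-- A solution of `ü + A u = 0` with vanishing initial data vanishes; here `b = A u`. -/
lemma wave_eq_zero (A : PosInvOp H) {u v a b : ℝ → H} {T : ℝ}
    (hu0 : u 0 = 0) (hv0 : v 0 = 0)
    (hu : ∀ t ∈ Icc 0 T, HasDerivWithinAt u (v t) (Icc 0 T) t)
    (hv : ∀ t ∈ Icc 0 T, HasDerivWithinAt v (a t) (Icc 0 T) t)
    (hb : ∀ t ∈ Icc 0 T, A.inv (b t) = u t) (hab : ∀ t ∈ Icc 0 T, a t = - b t)
    {t : ℝ} (ht : t ∈ Icc 0 T) : u t = 0 ∧ v t = 0 := by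
  -- The energy is taken one level lower, ‖A^{-1/2}v‖² + ‖u‖², because v is not assumed to lie in
  -- H_{1/2}.
  have hder : ∀ s ∈ Icc 0 T, HasDerivWithinAt
      (fun s => ‖A.invSqrt (v s)‖ ^ 2 + ‖u s‖ ^ 2) 0 (Icc 0 T) s := fun s hs => by
    have h1 := (hasDerivWithinAt_norm_sq (hasDerivWithinAt_clm A.invSqrt (hv s hs))).fun_add
      (hasDerivWithinAt_norm_sq (hu s hs))
    have h2 : (⟪A.invSqrt (v s), A.invSqrt (a s)⟫_ℂ).re = - (⟪u s, v s⟫_ℂ).re := by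
      rw [A.invSqrt_symm, A.invSqrt_invSqrt, hab s hs, map_neg, hb s hs, inner_neg_right,
        Complex.neg_re]
      exact congrArg Neg.neg (inner_re_symm (𝕜 := ℂ) _ _)
    rw [h2] at h1
    convert! h1 using 1
    ring
  have hanti : AntitoneOn (fun s => ‖A.invSqrt (v s)‖ ^ 2 + ‖u s‖ ^ 2) (Icc 0 T) :=
    antitoneOn_of_hasDerivWithinAt_nonpos (convex_Icc 0 T)
      (fun s hs => (hder s hs).continuousWithinAt)
      (fun s hs => (hder s (interior_subset hs)).mono interior_subset) fun s _ => le_rfl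
  have h := hanti (left_mem_Icc.mpr (ht.1.trans ht.2)) ht ht.1
  simp only [hu0, hv0, map_zero, norm_zero, ne_eq, OfNat.ofNat_ne_zero, not_false_eq_true,
    zero_pow, add_zero] at h
  have h1 : ‖u t‖ ^ 2 = 0 := by nlinarith [sq_nonneg ‖A.invSqrt (v t)‖, sq_nonneg ‖u t‖]
  have h2 : ‖A.invSqrt (v t)‖ ^ 2 = 0 := by
    nlinarith [sq_nonneg ‖A.invSqrt (v t)‖, sq_nonneg ‖u t‖]
  refine ⟨by simpa using h1, A.invSqrt_injective ?_⟩
  rw [map_zero]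
  simpa using h2

/-- Method of steps: for s in [T₀, (n+1)T₀] the time s - T₀ lies in [0, nT₀], where the velocities
agree by induction. The delay terms cancel and the difference solves the free wave equation from
zero data. -/
lemma IsDelaySolution.eqOn (hT₀ : 0 < T₀) {u₀ u₁ : H} {u v u' v' : ℝ → H}
    (h : IsDelaySolution A B μ T₀ u₀ u₁ u v) (h' : IsDelaySolution A B μ T₀ u₀ u₁ u' v') :
    EqOn u u' (Ici 0) := by
  obtain ⟨hu0, hv0, hu, a, -, ha, he⟩ := h
  obtain ⟨hu0', hv0', hu', a', -, ha', he'⟩ := h'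
  have key : ∀ n : ℕ, ∀ t ∈ Icc 0 (n * T₀), u t - u' t = 0 ∧ v t - v' t = 0 := by
    intro n
    induction n with
    | zero =>
      intro t ht
      have : t = 0 := le_antisymm (by simpa using ht.2) ht.1
      rw [this, hu0, hu0', hv0, hv0', sub_self, sub_self]
      exact ⟨rfl, rfl⟩
    | succ n ih =>
      choose hd he using he
      choose hd' he' using he'
      classical
      set b : ℝ → H := fun t => if ht : 0 ≤ t then A.op ⟨u t, hd t ht⟩ - A.op ⟨u' t, hd' t ht⟩
        else 0
      intro t ht
      refine wave_eq_zero A (u := fun t => u t - u' t) (v := fun t => v t - v' t)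
        (a := fun t => a t - a' t) (b := b) (by rw [hu0, hu0', sub_self])
        (by rw [hv0, hv0', sub_self])
        (fun s hs => ((hu s hs.1).sub (hu' s hs.1)).mono Icc_subset_Ici_self)
        (fun s hs => ((ha s hs.1).sub (ha' s hs.1)).mono Icc_subset_Ici_self)
        (fun s hs => ?_) (fun s hs => ?_) ht
      · simp only [b, hs.1, dite_true, map_sub, A.inv_op]
      · simp only [b, hs.1, dite_true]
        rcases le_total s T₀ with hs' | hs'
        · rw [eq_neg_of_add_eq_zero_left ((he s hs.1).1 hs'),
            eq_neg_of_add_eq_zero_left ((he' s hs.1).1 hs')]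
          abel
        · have h1 := (he s hs.1).2 hs'
          have h2 := (he' s hs.1).2 hs'
          have h3 := (ih (s - T₀) ⟨by linarith, by
            have := hs.2
            push_cast at this
            linarith⟩).2
          rw [sub_eq_zero.mp h3] at h1
          have h4 := h1.trans h2.symm
          rw [add_left_inj] at h4
          rw [neg_sub, sub_eq_sub_iff_add_eq_add, h4, add_comm]
  intro t ht
  obtain ⟨n, hn⟩ := exists_nat_ge (t / T₀)
  exact sub_eq_zero.mp (key n t ⟨ht, (div_le_iff₀ hT₀).mp hn⟩).1

lemma ContinuousOn.eq_zero_of_integral_eq_zero {E : Type*} [NormedAddCommGroup E]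
    [NormedSpace ℝ E] [CompleteSpace E] {f : ℝ → E} (hf : ContinuousOn f (Ici 0))
    (h : ∀ t, 0 ≤ t → ∫ s in (0 : ℝ)..t, f s = 0) {t : ℝ} (ht : 0 ≤ t) : f t = 0 := by
  have h1 := hasDerivWithinAt_integral_Ici hf ht
  have h2 : HasDerivWithinAt (fun t => ∫ s in (0 : ℝ)..t, f s) 0 (Ici 0) t :=
    (hasDerivWithinAt_const t (Ici 0) (0 : E)).congr h (h t ht)
  exact (uniqueDiffOn_Ici (0 : ℝ) t ht).eq_deriv _ h1 h2

/-- If the norm of the primitive of `f` is nonincreasing, then `f` vanishes. -/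
lemma integral_eq_zero_of_re_inner_nonpos {E : Type*} [NormedAddCommGroup E]
    [InnerProductSpace ℂ E] [CompleteSpace E] {f : ℝ → E} (hf : ContinuousOn f (Ici 0))
    (h : ∀ t, 0 ≤ t → (⟪∫ s in (0 : ℝ)..t, f s, f t⟫_ℂ).re ≤ 0) {t : ℝ} (ht : 0 ≤ t) :
    f t = 0 := by
  refine ContinuousOn.eq_zero_of_integral_eq_zero hf (fun t ht => ?_) ht
  have h1 := norm_le_of_re_inner_deriv_le (f := fun t => ∫ s in (0 : ℝ)..t, f s) (g := f) le_rfl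
    (fun s hs => hasDerivWithinAt_integral_Ici hf hs) (fun s hs => by simpa using h s hs) ht
  simpa using h1

/-! ### The delayed trace as an element of L²(0,1;U) -/

instance isFiniteMeasure_weighted (ξ : ℝ) :
    IsFiniteMeasure (ENNReal.ofReal ξ • (volume : Measure ℝ).restrict (Ioo 0 1)) :=
  Measure.smul_finite _ ENNReal.ofReal_ne_top

/-- Continuous functions on `[0,1]` as elements of `L²(0,1;U)`. -/
def contToL2 (ξ : ℝ) : C(Icc (0 : ℝ) 1, U) →L[ℂ] L2 U ξ :=
  BoundedContinuousFunction.toLp 2 _ ℂ ∘L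
    LinearMap.mkContinuous
      { toFun := fun f => (BoundedContinuousFunction.mkOfCompact f).compContinuous
          ⟨projIcc 0 1 zero_le_one, continuous_projIcc⟩
        map_add' := fun _ _ => rfl
        map_smul' := fun _ _ => rfl } 1 fun f => by
      rw [one_mul, BoundedContinuousFunction.norm_le (norm_nonneg f)]
      exact fun x => f.norm_coe_le_norm _

lemma contToL2_ae (hξ : 0 < ξ) (f : C(Icc (0 : ℝ) 1, U)) :
    contToL2 ξ f =ᵐ[volume.restrict (Ioo 0 1)] fun ρ => f (projIcc 0 1 zero_le_one ρ) :=
  (absCont hξ).ae_le (BoundedContinuousFunction.coeFn_toLp 2 _ ℂ _)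

/-- The function `ρ ↦ φ (t - T₀ ρ)` on `[0,1]`. -/
def delayed (T₀ : ℝ) (φ : C(ℝ, U)) : C(ℝ, C(Icc (0 : ℝ) 1, U)) :=
  ContinuousMap.curry ⟨fun p : ℝ × Icc (0 : ℝ) 1 => φ (p.1 - T₀ * p.2), by fun_prop⟩

lemma contToL2_delayed_ae (hξ : 0 < ξ) (T₀ : ℝ) (φ : C(ℝ, U)) (t : ℝ) :
    contToL2 ξ (delayed T₀ φ t) =ᵐ[volume.restrict (Ioo 0 1)] fun ρ => φ (t - T₀ * ρ) := by
  filter_upwards [contToL2_ae hξ (delayed T₀ φ t), ae_restrict_mem measurableSet_Ioo] with ρ h1 h2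
  rw [h1, projIcc_of_mem _ (Ioo_subset_Icc_self h2)]
  rfl

lemma contToL2_integral_delayed_ae (hξ : 0 < ξ) (hT₀ : 0 < T₀) (φ : C(ℝ, U))
    (hφ : ∀ s ≤ 0, φ s = 0) (t : ℝ) :
    contToL2 ξ (∫ s in (0 : ℝ)..t, delayed T₀ φ s) =ᵐ[volume.restrict (Ioo 0 1)]
      fun ρ => ∫ s in (0 : ℝ)..(t - T₀ * ρ), φ s := by
  filter_upwards [contToL2_ae hξ (∫ s in (0 : ℝ)..t, delayed T₀ φ s),
    ae_restrict_mem measurableSet_Ioo] with ρ h1 h2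
  have hρ := Ioo_subset_Icc_self h2
  have h3 := (ContinuousMap.evalCLM ℝ (⟨ρ, hρ⟩ : Icc (0 : ℝ) 1)).intervalIntegral_comp_comm
    ((delayed T₀ φ).continuous.intervalIntegrable (μ := volume) 0 t)
  have h4 : (∫ s in (0 : ℝ)..t, delayed T₀ φ s) ⟨ρ, hρ⟩ = ∫ s in (0 : ℝ)..t, φ (s - T₀ * ρ) :=
    h3.symm
  have h5 : ∫ s in (0 - T₀ * ρ)..0, φ s = 0 := by
    rw [intervalIntegral.integral_congr (g := fun _ => 0)]
    · simp
    · intro s hs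
      rw [uIcc_of_le (by nlinarith [hρ.1])] at hs
      exact hφ s hs.2
  rw [h1, projIcc_of_mem _ hρ, h4, intervalIntegral.integral_comp_sub_right,
    ← intervalIntegral.integral_add_adjacent_intervals (φ.continuous.intervalIntegrable _ 0)
      (φ.continuous.intervalIntegrable 0 _), h5, zero_add]

/-- With Φ(x) = ∫₀^x φ, the time integral of the delayed trace is Φ(t - T₀ρ), by the vanishing of φ
on (-∞,0]. The chain rule gives its ρ-derivative -T₀φ(t - T₀ρ), so it solves the same transport
equation as the integrated history. -/
lemma delayed_weakDeriv (hξ : 0 < ξ) (hT₀ : 0 < T₀) (φ : C(ℝ, U))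
    (hφ : ∀ s ≤ 0, φ s = 0) (t : ℝ) :
    IsWeakDeriv (contToL2 ξ (∫ s in (0 : ℝ)..t, delayed T₀ φ s))
      ((-(T₀ : ℂ)) • contToL2 ξ (delayed T₀ φ t) : L2 U ξ) ∧
    IsContRepr (contToL2 ξ (∫ s in (0 : ℝ)..t, delayed T₀ φ s))
      fun ρ => ∫ s in (0 : ℝ)..(t - T₀ * ρ), φ s := by
  have hae := contToL2_integral_delayed_ae hξ hT₀ φ hφ t
  have hd : ∀ ρ : ℝ, HasDerivAt (fun ρ => ∫ s in (0 : ℝ)..(t - T₀ * ρ), φ s)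
      ((-T₀) • φ (t - T₀ * ρ)) ρ := fun ρ => by
    have h1 : HasDerivAt (fun x => ∫ s in (0 : ℝ)..x, φ s) (φ (t - T₀ * ρ)) (t - T₀ * ρ) :=
      (φ.continuous.integral_hasStrictDerivAt 0 _).hasDerivAt
    have h2 : HasDerivAt (fun ρ : ℝ => t - T₀ * ρ) (-T₀) ρ := by
      simpa using ((hasDerivAt_id ρ).const_mul T₀).const_sub t
    exact h1.scomp ρ h2
  have hw : ((-(T₀ : ℂ)) • contToL2 ξ (delayed T₀ φ t) : L2 U ξ) =ᵐ[volume.restrict (Ioo 0 1)]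
      fun ρ => (-T₀) • φ (t - T₀ * ρ) := by
    filter_upwards [(absCont hξ).ae_le (Lp.coeFn_smul (-(T₀ : ℂ)) (contToL2 ξ (delayed T₀ φ t))),
      contToL2_delayed_ae hξ T₀ φ t] with ρ h1 h2
    rw [h1, Pi.smul_apply, h2, ← Complex.coe_smul, Complex.ofReal_neg]
  refine ⟨isWeakDeriv_of_eq_primitive (L2.integrableOn hξ _) (∫ s in (0 : ℝ)..t, φ s) ?_,
    (continuous_iff_continuousAt.mpr fun ρ => (hd ρ).continuousAt).continuousOn, hae⟩
  filter_upwards [hae, ae_restrict_mem measurableSet_Ioo] with ρ h1 h2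
  have h3 : ∫ s in (0 : ℝ)..ρ, ((-(T₀ : ℂ)) • contToL2 ξ (delayed T₀ φ t) : L2 U ξ) s =
      ∫ s in (0 : ℝ)..ρ, (-T₀) • φ (t - T₀ * s) := by
    rw [intervalIntegral.integral_of_le h2.1.le, intervalIntegral.integral_of_le h2.1.le,
      integral_Ioc_eq_integral_Ioo, integral_Ioc_eq_integral_Ioo]
    exact integral_congr_ae
      (ae_mono (Measure.restrict_mono (Ioo_subset_Ioo_right h2.2.le) le_rfl) hw)
  rw [h1, h3, intervalIntegral.integral_eq_sub_of_hasDerivAt (fun s _ => hd s)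
    (Continuous.intervalIntegrable (by fun_prop) _ _), mul_zero, sub_zero, add_sub_cancel]

/-- Dissipativity of the transport part for the difference of the history variable and the
delayed trace. -/
lemma GenRel.transport (hξ : 0 < ξ) (hT₀ : 0 < T₀) {P Q : Hg A U ξ}
    (h : GenRel A B μ T₀ ξ P Q) {φ : C(ℝ, U)} (hφ : ∀ s ≤ 0, φ s = 0) {t : ℝ}
    (ht : B.adjoint P.v = ∫ s in (0 : ℝ)..t, φ s) :
    (⟪P.z - contToL2 ξ (∫ s in (0 : ℝ)..t, delayed T₀ φ s),
      Q.z - contToL2 ξ (delayed T₀ φ t)⟫_ℂ).re ≤ 0 := by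
  obtain ⟨-, w, zc, hw, hc, hb, -, -, hQ⟩ := h
  obtain ⟨hw', hc'⟩ := delayed_weakDeriv hξ hT₀ φ hφ t
  set z' := contToL2 ξ (∫ s in (0 : ℝ)..t, delayed T₀ φ s)
  set y' := contToL2 ξ (delayed T₀ φ t)
  have e1 : (1 : ℂ) • P.z + (-1 : ℂ) • z' = P.z - z' := by module
  have hz := L2.coe_lin hξ (1 : ℂ) (-1) P.z z'
  have hW := L2.coe_lin hξ (1 : ℂ) (-1) w ((-(T₀ : ℂ)) • y')
  have h1 := IsWeakDeriv.lin (1 : ℂ) (-1) (L2.integrableOn hξ _) (L2.integrableOn hξ _)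
    (L2.integrableOn hξ _) (L2.integrableOn hξ _) hw hw' hz hW
  have h2 := IsContRepr.lin (1 : ℂ) (-1) hc hc' hz
  have h3 := h1.re_inner_eq hξ h2
  have hTc : (T₀ : ℂ) ≠ 0 := by exact_mod_cast hT₀.ne'
  have hQ' : Q.z = -((T₀ : ℂ)⁻¹ • w) := by
    rw [hQ]
    congr 1
    rw [← Complex.ofReal_inv]
    rfl
  have e2 : Q.z - y' = -((T₀⁻¹ : ℝ) : ℂ) • ((1 : ℂ) • w + (-1 : ℂ) • (-(T₀ : ℂ)) • y') := by
    rw [hQ', Complex.ofReal_inv, smul_add, smul_smul, smul_smul, smul_smul]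
    have : -(T₀ : ℂ)⁻¹ * -1 * -(T₀ : ℂ) = -1 := by field_simp
    rw [this]
    module
  have h4 : zc 0 = ∫ s in (0 : ℝ)..t, φ s := hb.trans ht
  rw [← e1, e2, inner_smul_right, ← Complex.ofReal_neg, Complex.re_ofReal_mul, h3]
  simp only [mul_zero, sub_zero, h4]
  -- The two traces at ρ = 0 coincide, so the inflow term vanishes and only the outflow term at ρ =
  -- 1, of dissipative sign, remains.
  have h5 : (1 : ℂ) • (∫ s in (0 : ℝ)..t, φ s) + (-1 : ℂ) • (∫ s in (0 : ℝ)..t, φ s) = 0 := by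
    module
  rw [h5, norm_zero, zero_pow two_ne_zero, sub_zero, neg_mul, neg_nonpos]
  positivity

/-- The compatibility condition for zero history: the trace of z = 0 at ρ = 0 is 0 and equals B^*v.
For the initial datum this is B^*u₁ = 0, which makes the extension of B^*v by zero to negative times
continuous. -/
lemma GenRel.adjoint_v_eq_zero (hξ : 0 < ξ) {u : A.Half} {v : H} {y : Hg A U ξ}
    (h : GenRel A B μ T₀ ξ (Hg.mk u v 0) y) : B.adjoint v = 0 := by
  obtain ⟨-, w, zc, -, hc, hb, -⟩ := h
  have hz : ((0 : L2 U ξ) : ℝ → U) =ᵐ[volume.restrict (Ioo 0 1)] 0 :=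
    (absCont hξ).ae_le (Lp.coeFn_zero _ _ _)
  have h0 : zc =ᵐ[volume.restrict (Icc (0 : ℝ) 1)] fun _ => (0 : U) := by
    rw [← restrict_Ioo_eq_restrict_Icc]
    exact hc.2.symm.trans hz
  exact hb.symm.trans (Measure.eqOn_Icc_of_ae_eq volume zero_ne_one h0 hc.1 continuousOn_const
    (left_mem_Icc.mpr zero_le_one))

/-- For a mild solution only the integrated state lies in the domain, so the transport estimate is
applied to ∫X. It shows that the primitive of z minus the delayed trace has nonincreasing norm;
starting from zero it vanishes, and so does its derivative. -/
lemma delay_history (hξ : 0 < ξ) (hT₀ : 0 < T₀) {u₀ : A.Half} {u₁ : H} {X : ℝ → Hg A U ξ}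
    (hX : IsMildSolution (Ag A B μ T₀ hξ) (Hg.mk u₀ u₁ 0) X) {φ : C(ℝ, U)}
    (hφ0 : ∀ s ≤ 0, φ s = 0) (hφ : ∀ s, 0 ≤ s → φ s = B.adjoint (X s).v) {t : ℝ} (ht : 0 ≤ t) :
    (X t).z = contToL2 ξ (delayed T₀ φ t) := by
  rw [isMildSolution_iff] at hX
  have hc1 : ContinuousOn (fun t => Hg.zL (X t)) (Ici 0) :=
    (Hg.zL : Hg A U ξ →L[ℂ] L2 U ξ).continuous.comp_continuousOn hX.1
  have hc2 : Continuous fun t => contToL2 ξ (delayed T₀ φ t) :=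
    (contToL2 ξ).continuous.comp (delayed T₀ φ).continuous
  have h := integral_eq_zero_of_re_inner_nonpos
    (f := fun t => Hg.zL (X t) - contToL2 ξ (delayed T₀ φ t)) (hc1.sub hc2.continuousOn)
    (fun t ht => ?_) ht
  · exact sub_eq_zero.mp h
  · rw [integral_sub_Ici hc1 hc2.continuousOn ht, ← integral_clm Hg.zL hX.1 ht,
      ← integral_clm (contToL2 ξ) (delayed T₀ φ).continuous.continuousOn ht]
    have h1 := GenRel.transport hξ hT₀ ((mem_Ag_graph hξ).mp (hX.2 t ht)) hφ0 (t := t) (by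
      have h2 := integral_clm (B.adjoint ∘L (Hg.vL : Hg A U ξ →L[ℂ] H)) hX.1 ht
      refine h2.trans (intervalIntegral.integral_congr fun s hs => ?_)
      rw [uIcc_of_le ht] at hs
      exact (hφ s hs.1).symm)
    have h3 : (X t - Hg.mk u₀ u₁ 0).z = (X t).z := sub_zero _
    rwa [h3] at h1

lemma exists_velocity_history {X : ℝ → Hg A U ξ}
    (hX : ContinuousOn X (Ici 0)) (h0 : B.adjoint (X 0).v = 0) :
    ∃ φ : C(ℝ, U), (∀ s ≤ 0, φ s = 0) ∧ ∀ s, 0 ≤ s → φ s = B.adjoint (X s).v := by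
  have hc : Continuous fun s => B.adjoint (Hg.vL (X (max s 0))) :=
    (B.adjoint ∘L (Hg.vL : Hg A U ξ →L[ℂ] H)).continuous.comp
      (hX.comp_continuous (by fun_prop) fun s => le_max_right s 0)
  refine ⟨⟨_, hc⟩, fun s hs => ?_, fun s hs => ?_⟩
  · change B.adjoint (Hg.vL (X (max s 0))) = 0
    rw [max_eq_right hs]
    exact h0
  · change B.adjoint (Hg.vL (X (max s 0))) = _
    rw [max_eq_left hs]
    rfl

/-- The trace at `1` of the history variable is the delayed velocity. -/
lemma contRepr_one_eq (hξ : 0 < ξ) {φ : C(ℝ, U)} {t : ℝ} {zc : ℝ → U}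
    (hc : IsContRepr (contToL2 ξ (delayed T₀ φ t)) zc) : zc 1 = φ (t - T₀) := by
  have h0 : zc =ᵐ[volume.restrict (Icc (0 : ℝ) 1)] fun ρ => φ (t - T₀ * ρ) := by
    rw [← restrict_Ioo_eq_restrict_Icc]
    exact hc.2.symm.trans (contToL2_delayed_ae hξ T₀ φ t)
  have h1 := Measure.eqOn_Icc_of_ae_eq volume zero_ne_one h0 hc.1
    (Continuous.continuousOn (by fun_prop)) (right_mem_Icc.mpr zero_le_one)
  simpa using h1

lemma isDelaySolution_of_classical (hξ : 0 < ξ) {u₀ : A.Half} {u₁ : H}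
    {X : ℝ → Hg A U ξ} (hX : IsClassicalSolution (Ag A B μ T₀ hξ) (Hg.mk u₀ u₁ 0) X)
    {φ : C(ℝ, U)} (hφ0 : ∀ s ≤ 0, φ s = 0) (hφ : ∀ s, 0 ≤ s → φ s = B.adjoint (X s).v)
    (hz : ∀ t, 0 ≤ t → (X t).z = contToL2 ξ (delayed T₀ φ t)) :
    IsDelaySolution A B μ T₀ (A.incl u₀) u₁ (fun t => A.incl (X t).u) (fun t => (X t).v) := by
  obtain ⟨hX0, -, Y, hY, hXY⟩ := hX
  have hrel : ∀ t, 0 ≤ t → GenRel A B μ T₀ ξ (X t) (Y t) := fun t ht =>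
    (mem_Ag_graph hξ).mp (mem_graph_iff_exists.mpr (hXY t ht).1)
  refine ⟨?_, ?_, fun t ht => ?_, fun t => (Y t).v,
    (Hg.vL : Hg A U ξ →L[ℂ] H).continuous.comp_continuousOn hY,
    fun t ht => hasDerivWithinAt_clm Hg.vL (hXY t ht).2, fun t ht => ?_⟩
  · change A.incl (X 0).u = _
    rw [hX0]
    rfl
  · change (X 0).v = _
    rw [hX0]
    rfl
  · have h1 := hasDerivWithinAt_clm (A.inclL ∘L (Hg.uL : Hg A U ξ →L[ℂ] A.Half)) (hXY t ht).2
    simp only [ContinuousLinearMap.comp_apply, A.inclL_apply, Hg.uL_apply] at h1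
    obtain ⟨-, -, -, -, -, -, e, -⟩ := hrel t ht
    rwa [e] at h1
  · obtain ⟨hu, w, zc, -, hc, -, -, f, -⟩ := hrel t ht
    rw [hz t ht] at hc
    have h1 := contRepr_one_eq hξ hc
    -- At t = T₀ both equations are required; they agree because φ(0) = 0.
    refine ⟨hu, fun h => ?_, fun h => ?_⟩ <;> beta_reduce
    · rw [f, h1, hφ0 _ (by linarith), map_zero, smul_zero, sub_zero, neg_add_cancel]
    · rw [f, h1, hφ _ (by linarith)]
      abel

end DelaySystem

end DelayWave

end

theorem mainTheorem2 {H : Type*} [NormedAddCommGroup H] [InnerProductSpace ℂ H] [CompleteSpace H]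
    {U : Type*} [NormedAddCommGroup U] [InnerProductSpace ℂ U] [CompleteSpace U]
    (A : DelayWave.PosInvOp H) (B : U →L[ℂ] H) (μ T₀ ξ : ℝ) (hT₀ : 0 < T₀) (hξ : 0 < ξ)
    (hμ : |μ| * T₀ ≤ ξ) :
    DelayWave.IsMaximalDissipativeShift (DelayWave.Ag A B μ T₀ hξ)
      ((|μ| / 2 + ξ / (2 * T₀)) * ‖B.adjoint‖ ^ 2) ∧
    ∀ (u₀ : A.Half) (u₁ : H), ∃ X : ℝ → DelayWave.Hg A U ξ,
      DelayWave.IsMildSolution (DelayWave.Ag A B μ T₀ hξ) (DelayWave.Hg.mk u₀ u₁ 0) X ∧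
      (∀ Y : ℝ → DelayWave.Hg A U ξ,
        DelayWave.IsMildSolution (DelayWave.Ag A B μ T₀ hξ) (DelayWave.Hg.mk u₀ u₁ 0) Y →
          Set.EqOn Y X (Set.Ici 0)) ∧
      (DelayWave.Hg.mk u₀ u₁ 0 ∈ (DelayWave.Ag A B μ T₀ hξ).domain →
        DelayWave.IsClassicalSolution (DelayWave.Ag A B μ T₀ hξ)
          (DelayWave.Hg.mk u₀ u₁ 0) X ∧
        DelayWave.IsDelaySolution A B μ T₀ (A.incl u₀) u₁
          (fun t => A.incl (X t).u) (fun t => (X t).v) ∧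
        (∀ u v : ℝ → H, DelayWave.IsDelaySolution A B μ T₀ (A.incl u₀) u₁ u v →
          Set.EqOn u (fun t => A.incl (X t).u) (Set.Ici 0)) ∧
        ∀ t, 0 ≤ t → ∀ᵐ ρ ∂(MeasureTheory.volume.restrict (Set.Ioo (0 : ℝ) 1)),
          (X t).z ρ = if T₀ * ρ ≤ t then B.adjoint (X (t - T₀ * ρ)).v else 0) := by

  have hG := DelayWave.Ag_isMaximalDissipativeShift (A := A) (B := B) hT₀ hξ hμ
  have hc : 0 ≤ DelayWave.growth B μ T₀ ξ := DelayWave.growth_nonneg hT₀ hξ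
  refine ⟨hG, fun u₀ u₁ => ?_⟩
  obtain ⟨X, hX⟩ := DelayWave.exists_mild hc hG (DelayWave.Hg.mk u₀ u₁ 0)
  refine ⟨X, hX, fun Y hY => DelayWave.mild_eqOn hc hG hY hX, fun hD => ?_⟩
  have hcl := DelayWave.isClassicalSolution_of_mild hc hG hD hX
  have h0 := DelayWave.GenRel.adjoint_v_eq_zero hξ ((DelayWave.mem_Ag_graph hξ).mp
    ((DelayWave.Ag A B μ T₀ hξ).mem_graph ⟨_, hD⟩))
  obtain ⟨φ, hφ0, hφ⟩ := DelayWave.exists_velocity_history (B := B) hcl.2.1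
    (by rw [hcl.1]; exact h0)
  have hz := fun t (ht : 0 ≤ t) => DelayWave.delay_history hξ hT₀ hX hφ0 hφ ht
  have hdel := DelayWave.isDelaySolution_of_classical hξ hcl hφ0 hφ hz
  refine ⟨hcl, hdel, fun u v h => h.eqOn hT₀ hdel, fun t ht => ?_⟩
  rw [hz t ht]
  filter_upwards [DelayWave.contToL2_delayed_ae hξ T₀ φ t] with ρ hρ
  rw [hρ]
  split_ifs with h
  · exact hφ _ (by linarith)
  · exact hφ0 _ (by linarith)
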